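/- **Setting.** Let $\Omega\subset\mathbb{R}^3$ be a Lipschitz domain whose complement $\Omega^c$ is compact and non-empty. Write $B_r(x_0)$ for open balls and $B_r=B_r(0)$. Let $r_1^*>0$ with $\Omega^c\subset B_{r_1^*}$, and let $\tilde\alpha\colon[0,\infty)\to[0,\infty)$ be continuous and non-decreasing, with $\tilde\alpha=0$ on $[0,r_1^*]$ and $\tilde\alpha>0$ on $(r_1^*,\infty)$, and twice continuously differentiable on $(r_1^*,\infty)$ with $\tilde\alpha,\tilde\alpha',\tilde\alpha''$ extending continuously to $[r_1^*,\infty)$. Put $$\tilde d=1+i\tilde\alpha,\quad \alpha(r)=r\tilde\alpha'(r)+\tilde\alpha(r),\quad d=1+i\alpha,\quad d_0=\lim_{r\to\infty}\tilde d(r)/|\tilde d(r)|,\quad P(x)=|x|^{-2}xx^\top,$$ let $\hat\alpha=\alpha$ on $(r_1^*,\infty)$, $\hat\alpha=\lim_{\rho\to r_1^*+}\alpha(\rho)$ on $[0,r_1^*]$, $\hat d=1+i\hat\alpha$, and write $f(x)=f(|x|)$ for radial functions. Assume moreover that $$\lim_{r\to\infty}\frac{\tilde d(r)|d(r)|}{|\tilde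 d(r)|d(r)}=1,\qquad \lim_{r\to\infty}\Big(\frac{\tilde d}{|\tilde d|}\Big)'(r)=\lim_{r\to\infty}\Big(\frac{d}{|d|}\Big)'(r)=0.$$ Let $X$ be the space of all $u\colon\Omega\to\mathbb{C}$ with $u\in H^1(\Omega\cap B_r)$ for all $r>0$ with $\Omega\cap B_r\ne\emptyset$, with trace $u|_{\partial\Omega}=0$ and with $\langle u,u\rangle_X<\infty$, where $$\langle u,u'\rangle_X=\big\langle(|\tilde d^2d^{-1}|P+|d|(I-P))\nabla u,\nabla u'\big\rangle_{L^2(\Omega)}+\big\langle|\tilde d^2d|u,u'\big\rangle_{L^2(\Omega)}.$$ **The operator.** Let $\arg$ take values in $[-\pi,\pi)$. For $\omega\in\mathbb{C}\setminus\{0\}$ let $$\eta=\overline{|\hat d|/\hat d}\ \text{ if }\arg(-\omega^2d_0^2)\in[-\pi,0),\qquad \eta=\overline{\frac{\hat d}{\tilde d^2}\frac{|\tilde d|^2}{|\hat d|}}\ \text{ if }\arg(-\omega^2d_0^2)\in[0,\pi).$$ Let $\epsilon_0(\omega)>0$ be arbitrary, and let $\eta_{\epsilon_0}$ be any function on $[0,\infty)$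 that is infinitely differentiable on $[r_1^*,\infty)$ with $\|\eta-\eta_{\epsilon_0}\|_{L^\infty(r_1^*,\infty)}<\epsilon_0(\omega)$, equal to $\eta(r_1^*)$ on $[0,\hat r_1]$ and to $\lim_{r\to\infty}\eta(r)$ on $[\hat r_2,\infty)$ for some $\hat r_1,\hat r_2>r_1^*$. Let $T_{\epsilon_0}(\omega)u:=\eta_{\epsilon_0}u$ for $u\in X$. **The subspaces and projections.** Let $X^{h(n)}\subset X$, $n\in\mathbb{N}$, be finite dimensional subspaces such that the orthogonal projections of $X$ onto $X^{h(n)}$ converge point-wise to the identity. Let $h(n)>0$, $h(n)\to0$, and let $\Pi_{h(n)}\colon X\to X^{h(n)}$ be bounded linear projections onto $X^{h(n)}$ for which there are constants $C_1,R^*>1$ such that 1. (locality) for all $n\in\mathbb{N}$, $x_0\in\Omega$ and $u\in X$: if $u=0$ on $\Omega\cap B_{R^*h(n)}(x_0)$, then $\Pi_{h(n)}u=0$ on $\Omega\cap B_{h(n)}(x_0)$; 2. (local approximation) for each compact $D\subset\Omega$ there is $n_0$ such that for all $n>n_0$, $s\in\{1,2\}$, all $x_0$ with $B_{R^*h(n)}(x_0)\subset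 D$ and all $u\in X$ with $u|_{B_{R^*h(n)}(x_0)}\in H^s(B_{R^*h(n)}(x_0))$, $$\|u-\Pi_{h(n)}u\|_{H^1(B_{h(n)}(x_0))}\le C_1h(n)^{s-1}\|u\|_{H^s(B_{R^*h(n)}(x_0))}.$$ Assume finally that for each compact $D\subset\Omega$ there is $n_0$ such that for each $n>n_0$ some $u_{D,n}\in X^{h(n)}$ satisfies $u_{D,n}|_D=1$. **Theorem.** For each $\omega\in\mathbb{C}\setminus\{0\}$, $T_{\epsilon_0}(\omega)$ is a bounded linear operator on $X$; for each $n$ the operator $T^{h(n)}_{\epsilon_0}(\omega):=\Pi_{h(n)}T_{\epsilon_0}(\omega)|_{X^{h(n)}}\in L(X^{h(n)})$ is Fredholm with index zero; and $$\lim_{n\to\infty}\|T_{\epsilon_0}(\omega)-T_{\epsilon_0}^{h(n)}(\omega)\|_n=0,\qquad \|A\|_n:=\sup_{u_n\in X^{h(n)}\setminus\{0\}}\|Au_n\|_X/\|u_n\|_X .$$ -/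

import Mathlib

open Filter Topology MeasureTheory Set
open scoped ENNReal NNReal InnerProductSpace

noncomputable section

namespace PML

/-- The space `ℝ³`. -/
abbrev E3 : Type := EuclideanSpace ℝ (Fin 3)

/-- The space `ℂ³`, in which gradients of complex valued functions take their values. -/
abbrev C3 : Type := EuclideanSpace ℂ (Fin 3)

/-! ### Domains -/

/-- `Ω` is a Lipschitz domain: open, connected, and near each boundary point it is, for a suitable
unit vector `ν`, the set of points above the graph of a Lipschitz function on the plane `ν^⊥`. -/
structure IsLipschitzDomain (Ω : Set E3) : Prop where
  isOpen : IsOpen Ω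
  isConnected : IsConnected Ω
  lipschitz_boundary : ∀ p ∈ frontier Ω, ∃ ν : E3, ‖ν‖ = 1 ∧
    ∃ (K : ℝ≥0) (γ : (ℝ ∙ ν)ᗮ → ℝ), LipschitzWith K γ ∧
      ∃ U ∈ 𝓝 p, ∀ x ∈ U, x ∈ Ω ↔ γ ((ℝ ∙ ν)ᗮ.orthogonalProjectionOnto x) < ⟪ν, x⟫_ℝ

/-! ### The complex scaling -/

/-- A profile function `α̃` of a complex scaling for the exterior domain `Ω`, together with the
radius `r₁` at which the scaling starts. The profile is extended by zero to negative arguments. -/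
structure Profile (Ω : Set E3) where
  r₁ : ℝ
  r₁_pos : 0 < r₁
  compl_subset : Ωᶜ ⊆ Metric.ball 0 r₁
  /-- the profile function -/
  αt : ℝ → ℝ
  αt_zero : ∀ r, r ≤ r₁ → αt r = 0
  αt_cont : Continuous αt
  αt_pos : ∀ r, r₁ < r → 0 < αt r
  αt_mono : Monotone αt
  αt_C2 : ContDiffOn ℝ 2 αt (Ioi r₁)
  αt_deriv_ext : ∃ l : ℝ, Tendsto (deriv αt) (𝓝[>] r₁) (𝓝 l)
  αt_deriv2_ext : ∃ l : ℝ, Tendsto (deriv (deriv αt)) (𝓝[>] r₁) (𝓝 l)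

namespace Profile

variable {Ω : Set E3} (S : Profile Ω)

/-- `d̃(r) = 1 + i α̃(r)` -/
def dt (r : ℝ) : ℂ := 1 + Complex.I * (S.αt r : ℂ)

/-- `α(r) = r α̃'(r) + α̃(r)` -/
def α (r : ℝ) : ℝ := r * deriv S.αt r + S.αt r

/-- `d(r) = 1 + i α(r)` -/
def d (r : ℝ) : ℂ := 1 + Complex.I * (S.α r : ℂ)

/-- `d₀ = lim_{r → ∞} d̃(r) / |d̃(r)|` (the limit exists, see `tendsto_d₀`) -/
def d₀ : ℂ := limUnder atTop (fun r : ℝ => S.dt r / (‖S.dt r‖ : ℂ))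

/-- `α̂ = α` beyond `r₁`, and `α̂` is constant up to `r₁`, with the value `α(r₁+)`
(the limit exists, see `tendsto_α`) -/
def αh (r : ℝ) : ℝ := if r ≤ S.r₁ then limUnder (𝓝[>] S.r₁) S.α else S.α r

/-- `d̂(r) = 1 + i α̂(r)` -/
def dh (r : ℝ) : ℂ := 1 + Complex.I * (S.αh r : ℂ)

/-- The additional assumptions on the behaviour of the profile at infinity. -/
structure IsAsymptotic : Prop where
  lim_phase : Tendsto (fun r : ℝ => S.dt r * (‖S.d r‖ : ℂ) / ((‖S.dt r‖ : ℂ) * S.d r))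
    atTop (𝓝 1)
  lim_deriv_dt : Tendsto (deriv fun r : ℝ => S.dt r / (‖S.dt r‖ : ℂ)) atTop (𝓝 0)
  lim_deriv_d : Tendsto (deriv fun r : ℝ => S.d r / (‖S.d r‖ : ℂ)) atTop (𝓝 0)

lemma tendsto_d₀ : Tendsto (fun r : ℝ => S.dt r / (‖S.dt r‖ : ℂ)) atTop (𝓝 S.d₀) := by
  refine tendsto_nhds_limUnder ?_
  have key : ∀ a : ℝ, (1 + Complex.I * (a : ℂ)) / (‖1 + Complex.I * (a : ℂ)‖ : ℂ)
      = ((Real.cos (Real.arctan a) : ℝ) : ℂ) + Complex.I * ((Real.sin (Real.arctan a) : ℝ) : ℂ) := by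
    intro a
    have hn : ‖1 + Complex.I * (a : ℂ)‖ = √(1 + a ^ 2) := by
      rw [Complex.norm_eq_sqrt_sq_add_sq]; simp
    have hpos : (0 : ℝ) < √(1 + a ^ 2) := Real.sqrt_pos.2 (by positivity)
    have hne : ((√(1 + a ^ 2) : ℝ) : ℂ) ≠ 0 := by exact_mod_cast hpos.ne'
    rw [hn, Real.cos_arctan, Real.sin_arctan]
    push_cast
    field_simp
  have harc : ∃ l : ℝ, Tendsto (fun r => Real.arctan (S.αt r)) atTop (𝓝 l) := by
    refine ⟨_, tendsto_atTop_ciSup (Real.arctan_mono.comp S.αt_mono) ⟨Real.pi / 2, ?_⟩⟩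
    rintro _ ⟨r, rfl⟩
    exact (Real.arctan_lt_pi_div_two _).le
  obtain ⟨l, hl⟩ := harc
  refine ⟨((Real.cos l : ℝ) : ℂ) + Complex.I * ((Real.sin l : ℝ) : ℂ), ?_⟩
  have : (fun r : ℝ => S.dt r / (‖S.dt r‖ : ℂ)) = fun r =>
      ((Real.cos (Real.arctan (S.αt r)) : ℝ) : ℂ)
        + Complex.I * ((Real.sin (Real.arctan (S.αt r)) : ℝ) : ℂ) := by
    funext r; exact key _
  rw [this]
  have hc : Continuous fun t : ℝ =>
      ((Real.cos t : ℝ) : ℂ) + Complex.I * ((Real.sin t : ℝ) : ℂ) := by fun_prop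
  exact (hc.tendsto l).comp hl

lemma tendsto_α : Tendsto S.α (𝓝[>] S.r₁) (𝓝 (limUnder (𝓝[>] S.r₁) S.α)) := by
  refine tendsto_nhds_limUnder ?_
  obtain ⟨l, hl⟩ := S.αt_deriv_ext
  have hid : Tendsto (fun r : ℝ => r) (𝓝[>] S.r₁) (𝓝 S.r₁) :=
    tendsto_id.mono_left nhdsWithin_le_nhds
  exact ⟨_, (hid.mul hl).add ((S.αt_cont.tendsto S.r₁).mono_left nhdsWithin_le_nhds)⟩

/-! ### The weighted inner product -/

/-- The vector `x ∈ ℝ³` as an element of `ℂ³`. -/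
def _root_.PML.toC (x : E3) : C3 := WithLp.toLp 2 fun i => (x i : ℂ)

/-- The matrix `P(x) = |x|⁻² x xᵀ` -/
def _root_.PML.radProj (x : E3) : C3 →L[ℂ] C3 :=
  (((‖x‖ ^ 2)⁻¹ : ℝ) : ℂ) • InnerProductSpace.rankOne ℂ (toC x) (toC x)

/-- The matrix `|d̃² d⁻¹| P + |d| (I - P)` at the point `x` -/
def W (x : E3) : C3 →L[ℂ] C3 :=
  (‖S.dt ‖x‖ ^ 2 * (S.d ‖x‖)⁻¹‖ : ℂ) • radProj x
    + (‖S.d ‖x‖‖ : ℂ) • (ContinuousLinearMap.id ℂ C3 - radProj x)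

/-- The weight `|d̃² d|` at the point `x` -/
def w (x : E3) : ℝ := ‖S.dt ‖x‖ ^ 2 * S.d ‖x‖‖

end Profile

/-! ### Weak derivatives and traces -/

/-- The `i`-th unit vector of `ℝ³` -/
def e (i : Fin 3) : E3 := EuclideanSpace.single i 1

/-- The classical gradient of a complex valued function on `ℝ³` -/
def grad (φ : E3 → ℂ) (x : E3) : C3 := WithLp.toLp 2 fun i => fderiv ℝ φ x (e i)

/-- `g` is the weak gradient of `u` on `D` (for locally integrable `u`, `g` on the open set `D`). -/
def IsWeakGradient (D : Set E3) (u : E3 → ℂ) (g : E3 → C3) : Prop :=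
  ∀ φ : E3 → ℝ, ContDiff ℝ (⊤ : ℕ∞) φ → HasCompactSupport φ → tsupport φ ⊆ D → ∀ i : Fin 3,
    ∫ x in D, ((fderiv ℝ φ x (e i) : ℝ) : ℂ) * u x = - ∫ x in D, ((φ x : ℝ) : ℂ) * g x i

/-- `τ` is the trace on `∂Ω` of the function `u` with weak gradient `g`: smooth functions on `ℝ³`
converge at the same time to `u` in `H¹(Ω ∩ B_r)` and to `τ` in `L²(∂Ω)`, where `∂Ω` carries its
surface measure. That is, the trace is the continuous extension of the restriction to `∂Ω` of
functions that are smooth up to the boundary. -/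
def HasTrace (Ω : Set E3) (u : E3 → ℂ) (g : E3 → C3) (τ : E3 → ℂ) : Prop :=
  ∀ r : ℝ, 0 < r → ∀ δ : ℝ≥0∞, 0 < δ → ∃ φ : E3 → ℂ, ContDiff ℝ (⊤ : ℕ∞) φ ∧ HasCompactSupport φ ∧
    eLpNorm (fun x => φ x - u x) 2 (volume.restrict (Ω ∩ Metric.ball 0 r)) < δ ∧
    eLpNorm (fun x => grad φ x - g x) 2 (volume.restrict (Ω ∩ Metric.ball 0 r)) < δ ∧
    eLpNorm (fun x => φ x - τ x) 2 ((μH[2] : Measure E3).restrict (frontier Ω)) < δ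

/-! ### The space `X` -/

/-- Membership in `X` for a function `u` with gradient `g`: `u` is `H¹` on all bounded parts of
`Ω`, its trace on `∂Ω` vanishes, and the weighted norm is finite. -/
structure MemX {Ω : Set E3} (S : Profile Ω) (u : E3 → ℂ) (g : E3 → C3) : Prop where
  memLp : ∀ r : ℝ, 0 < r → MemLp u 2 (volume.restrict (Ω ∩ Metric.ball 0 r))
  memLp_grad : ∀ r : ℝ, 0 < r → MemLp g 2 (volume.restrict (Ω ∩ Metric.ball 0 r))
  weakGradient : IsWeakGradient Ω u g
  trace : HasTrace Ω u g 0
  finite_grad : IntegrableOn (fun x => RCLike.re ⟪g x, S.W x (g x)⟫_ℂ) Ω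
  finite : IntegrableOn (fun x => S.w x * ‖u x‖ ^ 2) Ω

section Facts

variable {Ω : Set E3} (S : Profile Ω)

lemma toC_norm (x : E3) : ‖toC x‖ = ‖x‖ := by
  simp [toC, EuclideanSpace.norm_eq]

lemma radProj_eq (x : E3) : radProj x = (ℂ ∙ toC x).starProjection := by
  ext1 g
  rw [Submodule.starProjection_singleton, radProj, toC_norm]
  simp only [smul_apply, InnerProductSpace.rankOne_apply, smul_smul]
  congr 1
  push_cast
  rw [div_eq_inv_mul]
  rfl

lemma one_le_norm (a : ℝ) : 1 ≤ ‖1 + Complex.I * (a : ℂ)‖ := by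
  have := Complex.abs_re_le_norm (1 + Complex.I * (a : ℂ))
  simpa using this

lemma inner_W (x : E3) (g h : C3) :
    ⟪h, S.W x g⟫_ℂ = (‖S.dt ‖x‖ ^ 2 * (S.d ‖x‖)⁻¹‖ : ℂ) * ⟪radProj x h, radProj x g⟫_ℂ
      + (‖S.d ‖x‖‖ : ℂ) * ⟪h - radProj x h, g - radProj x g⟫_ℂ := by
  rw [radProj_eq]
  set K := (ℂ ∙ toC x)
  have h1 : ⟪h, K.starProjection g⟫_ℂ = ⟪K.starProjection h, K.starProjection g⟫_ℂ := by
    rw [Submodule.inner_starProjection_left_eq_right,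
      Submodule.starProjection_eq_self_iff.2 (Submodule.starProjection_apply_mem _ _)]
  have h2 : ⟪K.starProjection h, g⟫_ℂ = ⟪K.starProjection h, K.starProjection g⟫_ℂ := by
    rw [← Submodule.inner_starProjection_left_eq_right,
      Submodule.starProjection_eq_self_iff.2 (Submodule.starProjection_apply_mem _ _)]
  simp only [Profile.W, radProj_eq, add_apply, smul_apply,
    sub_apply, ContinuousLinearMap.id_apply, inner_add_right, inner_smul_right,
    inner_sub_right, inner_sub_left]
  change _ * ⟪h, K.starProjection g⟫_ℂ + _ * (_ - ⟪h, K.starProjection g⟫_ℂ) = _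
  rw [h1, h2]
  ring

lemma re_inner_W (x : E3) (g : C3) :
    RCLike.re ⟪g, S.W x g⟫_ℂ = ‖S.dt ‖x‖ ^ 2 * (S.d ‖x‖)⁻¹‖ * ‖radProj x g‖ ^ 2
      + ‖S.d ‖x‖‖ * ‖g - radProj x g‖ ^ 2 := by
  rw [inner_W, inner_self_eq_norm_sq_to_K, inner_self_eq_norm_sq_to_K]
  simp [← Complex.ofReal_pow]

lemma norm_inner_W_le (x : E3) (g h : C3) :
    ‖⟪h, S.W x g⟫_ℂ‖ ≤ RCLike.re ⟪g, S.W x g⟫_ℂ + RCLike.re ⟪h, S.W x h⟫_ℂ := by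
  rw [inner_W, re_inner_W, re_inner_W]
  refine (norm_add_le _ _).trans ?_
  rw [norm_mul ((_ : ℝ) : ℂ), norm_mul ((_ : ℝ) : ℂ), Complex.norm_real, Complex.norm_real,
    norm_norm, norm_norm]
  have e1 := norm_inner_le_norm (𝕜 := ℂ) (radProj x h) (radProj x g)
  have e2 := norm_inner_le_norm (𝕜 := ℂ) (h - radProj x h) (g - radProj x g)
  have ha : 0 ≤ ‖S.dt ‖x‖ ^ 2 * (S.d ‖x‖)⁻¹‖ := norm_nonneg _
  have hb : 0 ≤ ‖S.d ‖x‖‖ := norm_nonneg _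
  have f1 : ‖⟪radProj x h, radProj x g⟫_ℂ‖ ≤ ‖radProj x g‖ ^ 2 + ‖radProj x h‖ ^ 2 := by
    nlinarith [sq_nonneg (‖radProj x g‖ - ‖radProj x h‖), sq_nonneg (‖radProj x g‖),
      sq_nonneg (‖radProj x h‖)]
  have f2 : ‖⟪h - radProj x h, g - radProj x g⟫_ℂ‖
      ≤ ‖g - radProj x g‖ ^ 2 + ‖h - radProj x h‖ ^ 2 := by
    nlinarith [sq_nonneg (‖g - radProj x g‖ - ‖h - radProj x h‖), sq_nonneg (‖g - radProj x g‖),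
      sq_nonneg (‖h - radProj x h‖)]
  nlinarith [mul_le_mul_of_nonneg_left f1 ha, mul_le_mul_of_nonneg_left f2 hb]

lemma inner_W_symm (x : E3) (g h : C3) :
    (starRingEnd ℂ) ⟪g, S.W x h⟫_ℂ = ⟪h, S.W x g⟫_ℂ := by
  rw [inner_W, inner_W, map_add, map_mul, map_mul, inner_conj_symm, inner_conj_symm,
    Complex.conj_ofReal, Complex.conj_ofReal]

lemma one_le_w (x : E3) : 1 ≤ S.w x := by
  rw [Profile.w, norm_mul, norm_pow]
  have h1 : 1 ≤ ‖S.dt ‖x‖‖ := one_le_norm _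
  have h2 : 1 ≤ ‖S.d ‖x‖‖ := one_le_norm _
  exact one_le_mul_of_one_le_of_one_le (one_le_pow₀ h1) h2

lemma re_inner_W_nonneg (x : E3) (g : C3) : 0 ≤ RCLike.re ⟪g, S.W x g⟫_ℂ := by
  rw [re_inner_W]; positivity

lemma eq_zero_of_re_inner_W (x : E3) (g : C3) (hg : RCLike.re ⟪g, S.W x g⟫_ℂ = 0) : g = 0 := by
  rw [re_inner_W] at hg
  have h1 : 1 ≤ ‖S.dt ‖x‖‖ := one_le_norm _
  have h2 : 1 ≤ ‖S.d ‖x‖‖ := one_le_norm _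
  have ha : 0 < ‖S.dt ‖x‖ ^ 2 * (S.d ‖x‖)⁻¹‖ := by
    rw [norm_mul, norm_pow, norm_inv]; positivity
  have hb : 0 < ‖S.d ‖x‖‖ := by positivity
  have p1 : 0 ≤ ‖S.dt ‖x‖ ^ 2 * (S.d ‖x‖)⁻¹‖ * ‖radProj x g‖ ^ 2 := by positivity
  have p2 : 0 ≤ ‖S.d ‖x‖‖ * ‖g - radProj x g‖ ^ 2 := by positivity
  have q1 : ‖S.dt ‖x‖ ^ 2 * (S.d ‖x‖)⁻¹‖ * ‖radProj x g‖ ^ 2 = 0 := by linarith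
  have q2 : ‖S.d ‖x‖‖ * ‖g - radProj x g‖ ^ 2 = 0 := by linarith
  have r1 : radProj x g = 0 := by
    have := (mul_eq_zero.1 q1).resolve_left ha.ne'
    simpa using this
  have r2 : g - radProj x g = 0 := by
    have := (mul_eq_zero.1 q2).resolve_left hb.ne'
    simpa using this
  rwa [r1, sub_zero] at r2

/-! Measurability of the weights -/

lemma measurable_dt : Measurable fun x : E3 => S.dt ‖x‖ := by
  have := S.αt_cont
  unfold Profile.dt
  fun_prop

lemma measurable_d : Measurable fun x : E3 => S.d ‖x‖ := by
  have h1 := S.αt_cont.measurable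
  have h2 : Measurable (deriv S.αt) := measurable_deriv S.αt
  unfold Profile.d Profile.α
  fun_prop

lemma measurable_w : Measurable S.w := by
  have h1 := measurable_dt S
  have h2 := measurable_d S
  unfold Profile.w
  fun_prop

lemma aestronglyMeasurable_W {μ : Measure E3} {g : E3 → C3} (hg : AEStronglyMeasurable g μ) :
    AEStronglyMeasurable (fun x => S.W x (g x)) μ := by
  have h1 := (measurable_dt S).aestronglyMeasurable (μ := μ)
  have h2 := (measurable_d S).aestronglyMeasurable (μ := μ)
  have hC : Continuous toC := by unfold toC; fun_prop
  have h3 := hC.aestronglyMeasurable (μ := μ)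
  have h4 : AEStronglyMeasurable (fun x => radProj x (g x)) μ := by
    simp only [radProj, smul_apply, InnerProductSpace.rankOne_apply]
    have : Measurable fun x : E3 => (((‖x‖ ^ 2)⁻¹ : ℝ) : ℂ) := by fun_prop
    exact this.aestronglyMeasurable.smul ((h3.inner (𝕜 := ℂ) hg).smul h3)
  simp only [Profile.W, add_apply, smul_apply,
    sub_apply, ContinuousLinearMap.id_apply]
  have m1 : Measurable fun x : E3 => (‖S.dt ‖x‖ ^ 2 * (S.d ‖x‖)⁻¹‖ : ℂ) := by
    have h1 := measurable_dt S
    have h2 := measurable_d S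
    fun_prop
  have m2 : Measurable fun x : E3 => (‖S.d ‖x‖‖ : ℂ) := by
    have h2 := measurable_d S
    fun_prop
  exact (m1.aestronglyMeasurable.smul h4).add (m2.aestronglyMeasurable.smul (hg.sub h4))

lemma integrable_inner_W {μ : Measure E3} {g h : E3 → C3}
    (mg : AEStronglyMeasurable g μ) (mh : AEStronglyMeasurable h μ)
    (hg : Integrable (fun x => RCLike.re ⟪g x, S.W x (g x)⟫_ℂ) μ)
    (hh : Integrable (fun x => RCLike.re ⟪h x, S.W x (h x)⟫_ℂ) μ) :
    Integrable (fun x => ⟪h x, S.W x (g x)⟫_ℂ) μ :=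
  (hg.add hh).mono' (mh.inner (aestronglyMeasurable_W S mg))
    (ae_of_all _ fun x => norm_inner_W_le S x (g x) (h x))

lemma integrable_w_mul {μ : Measure E3} {u v : E3 → ℂ}
    (mu : AEStronglyMeasurable u μ) (mv : AEStronglyMeasurable v μ)
    (hu : Integrable (fun x => S.w x * ‖u x‖ ^ 2) μ)
    (hv : Integrable (fun x => S.w x * ‖v x‖ ^ 2) μ) :
    Integrable (fun x => (S.w x : ℂ) * ((starRingEnd ℂ) (v x) * u x)) μ := by
  refine (hu.add hv).mono' ?_ (ae_of_all _ fun x => ?_)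
  · have : Measurable fun x => (S.w x : ℂ) := by
      have := measurable_w S
      fun_prop
    exact this.aestronglyMeasurable.mul
      ((Complex.continuous_conj.comp_aestronglyMeasurable mv).mul mu)
  · have hw : 0 ≤ S.w x := zero_le_one.trans (one_le_w S x)
    have : ‖(S.w x : ℂ) * ((starRingEnd ℂ) (v x) * u x)‖ = S.w x * (‖v x‖ * ‖u x‖) := by
      rw [norm_mul, norm_mul, RCLike.norm_conj, Complex.norm_real, Real.norm_of_nonneg hw]
    rw [this]
    simp only [Pi.add_apply]
    nlinarith [mul_nonneg hw (sq_nonneg (‖u x‖ - ‖v x‖)), mul_nonneg hw (sq_nonneg ‖u x‖),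
      mul_nonneg hw (sq_nonneg ‖v x‖)]

/-! `X` is a vector space -/

lemma integrableOn_test {u : E3 → ℂ} {ψ : E3 → ℝ} (hψ : Continuous ψ) (hc : HasCompactSupport ψ)
    (hu : ∀ r : ℝ, 0 < r → MemLp u 2 (volume.restrict (Ω ∩ Metric.ball 0 r))) :
    IntegrableOn (fun x => ((ψ x : ℝ) : ℂ) * u x) Ω := by
  obtain ⟨R, hR0, hR⟩ : ∃ R : ℝ, 0 < R ∧ tsupport ψ ⊆ Metric.ball 0 R := by
    obtain ⟨R, hR0, hR⟩ := hc.isCompact.isBounded.subset_ball_lt 0 0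
    exact ⟨R, hR0, hR⟩
  have h1 : IntegrableOn (fun x => ((ψ x : ℝ) : ℂ) * u x) (Ω ∩ Metric.ball 0 R) := by
    have hfin : volume (Ω ∩ Metric.ball (0 : E3) R) ≠ ⊤ :=
      ((measure_mono inter_subset_right).trans_lt measure_ball_lt_top).ne
    have : IsFiniteMeasure (volume.restrict (Ω ∩ Metric.ball (0 : E3) R)) :=
      ⟨by simpa using hfin.lt_top⟩
    obtain ⟨C, hC⟩ := hc.exists_bound_of_continuous hψ
    have hint : Integrable u (volume.restrict (Ω ∩ Metric.ball (0 : E3) R)) :=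
      (hu R hR0).integrable (by norm_num)
    refine hint.bdd_mul (c := C) ?_ (ae_of_all _ fun x => ?_)
    · exact (Complex.continuous_ofReal.comp hψ).aestronglyMeasurable
    · simpa using hC x
  have h2 : (fun x => ((ψ x : ℝ) : ℂ) * u x)
      = (Metric.ball (0 : E3) R).indicator (fun x => ((ψ x : ℝ) : ℂ) * u x) := by
    funext x
    by_cases hx : x ∈ Metric.ball (0 : E3) R
    · simp only [indicator_of_mem hx]
    · have : ψ x = 0 := image_eq_zero_of_notMem_tsupport fun h => hx (hR h)
      rw [indicator_of_notMem hx, this]; simp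
  rw [IntegrableOn, h2, integrable_indicator_iff measurableSet_ball, IntegrableOn,
    Measure.restrict_restrict measurableSet_ball, inter_comm]
  exact h1


lemma MemX.add {S : Profile Ω} {u v : E3 → ℂ} {g h : E3 → C3} (hu : MemX S u g) (hv : MemX S v h)
    (mu : AEStronglyMeasurable u (volume.restrict Ω))
    (mv : AEStronglyMeasurable v (volume.restrict Ω))
    (mg : AEStronglyMeasurable g (volume.restrict Ω))
    (mh : AEStronglyMeasurable h (volume.restrict Ω)) :
    MemX S (fun x => u x + v x) (fun x => g x + h x) where
  memLp r hr := (hu.memLp r hr).add (hv.memLp r hr)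
  memLp_grad r hr := (hu.memLp_grad r hr).add (hv.memLp_grad r hr)
  weakGradient φ hφ hc hs i := by
    have c1 : Continuous fun x => fderiv ℝ φ x (e i) :=
      (hφ.continuous_fderiv (by simp)).clm_apply continuous_const
    have c2 : HasCompactSupport fun x => fderiv ℝ φ x (e i) := hc.fderiv_apply (𝕜 := ℝ) (e i)
    have comp : ∀ {k : E3 → C3}, (∀ r : ℝ, 0 < r →
        MemLp k 2 (volume.restrict (Ω ∩ Metric.ball 0 r))) → ∀ r : ℝ, 0 < r →
        MemLp (fun x => k x i) 2 (volume.restrict (Ω ∩ Metric.ball 0 r)) := by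
      intro k hk r hr
      exact (EuclideanSpace.proj (𝕜 := ℂ) i : C3 →L[ℂ] ℂ).comp_memLp' (hk r hr)
    have a1 := hu.weakGradient φ hφ hc hs i
    have a2 := hv.weakGradient φ hφ hc hs i
    simp only [PiLp.add_apply, mul_add]
    rw [integral_add (integrableOn_test c1 c2 hu.memLp) (integrableOn_test c1 c2 hv.memLp),
      integral_add (integrableOn_test hφ.continuous hc (comp hu.memLp_grad))
        (integrableOn_test hφ.continuous hc (comp hv.memLp_grad)), a1, a2]
    ring
  trace r hr δ hδ := by
    have hδ2 : 0 < δ / 2 := ENNReal.half_pos hδ.ne'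
    obtain ⟨φ, s1, k1, a1, b1, t1⟩ := hu.trace r hr _ hδ2
    obtain ⟨ψ, s2, k2, a2, b2, t2⟩ := hv.trace r hr _ hδ2
    have cg : ∀ {f : E3 → ℂ}, ContDiff ℝ (⊤ : ℕ∞) f → Continuous (grad f) := by
      intro f hf
      have : ∀ i, Continuous fun x => fderiv ℝ f x (e i) := fun i =>
        (hf.continuous_fderiv (by simp)).clm_apply continuous_const
      unfold grad
      fun_prop
    have tri : ∀ {F : Type} [NormedAddCommGroup F] {μ : Measure E3} {p q : E3 → F},
        AEStronglyMeasurable p μ → AEStronglyMeasurable q μ → eLpNorm p 2 μ < δ / 2 →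
        eLpNorm q 2 μ < δ / 2 → eLpNorm (p + q) 2 μ < δ := by
      intro F _ μ p q hp hq h1 h2
      calc eLpNorm (p + q) 2 μ ≤ eLpNorm p 2 μ + eLpNorm q 2 μ :=
            eLpNorm_add_le hp hq (by norm_num)
        _ < δ / 2 + δ / 2 := ENNReal.add_lt_add h1 h2
        _ = δ := ENNReal.add_halves δ
    refine ⟨fun x => φ x + ψ x, s1.add s2, k1.add k2, ?_, ?_, ?_⟩
    · refine lt_of_eq_of_lt ?_ (tri (s1.continuous.aestronglyMeasurable.sub (hu.memLp r hr).1)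
        (s2.continuous.aestronglyMeasurable.sub (hv.memLp r hr).1) a1 a2)
      congr 1
      funext x; simp only [Pi.add_apply, Pi.sub_apply]; ring
    · refine lt_of_eq_of_lt ?_ (tri ((cg s1).aestronglyMeasurable.sub (hu.memLp_grad r hr).1)
        ((cg s2).aestronglyMeasurable.sub (hv.memLp_grad r hr).1) b1 b2)
      congr 1
      funext x
      have : grad (fun x => φ x + ψ x) x = grad φ x + grad ψ x := by
        ext i
        simp only [grad, PiLp.add_apply]
        rw [fderiv_fun_add (s1.differentiable (by simp) x) (s2.differentiable (by simp) x)]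
        rfl
      rw [this]
      simp only [Pi.add_apply, Pi.sub_apply]
      abel
    · convert tri (s1.continuous.aestronglyMeasurable.sub
          (aestronglyMeasurable_const (b := (0 : ℂ))))
        (s2.continuous.aestronglyMeasurable.sub
          (aestronglyMeasurable_const (b := (0 : ℂ)))) t1 t2 using 2
      funext x; simp
  finite_grad := by
    have i1 := integrable_inner_W S mg mh hu.finite_grad hv.finite_grad
    have i2 := integrable_inner_W S mh mg hv.finite_grad hu.finite_grad
    refine ((hu.finite_grad.add hv.finite_grad).add (i1.re.add i2.re)).congr
      (ae_of_all _ fun x => ?_)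
    simp only [Pi.add_apply, map_add, inner_add_left, inner_add_right]
    ring
  finite := by
    refine ((hu.finite.add hv.finite).const_mul 2).mono' ?_ (ae_of_all _ fun x => ?_)
    · exact (measurable_w S).aestronglyMeasurable.mul ((mu.add mv).norm.pow 2)
    · have hw : 0 ≤ S.w x := zero_le_one.trans (one_le_w S x)
      rw [Real.norm_of_nonneg (by positivity)]
      have h1 : ‖u x + v x‖ ^ 2 ≤ 2 * (‖u x‖ ^ 2 + ‖v x‖ ^ 2) := by
        have := norm_add_le (u x) (v x)
        have h0 := norm_nonneg (u x + v x)
        nlinarith [sq_nonneg (‖u x‖ - ‖v x‖)]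
      simp only [Pi.add_apply]
      nlinarith [mul_le_mul_of_nonneg_left h1 hw]

lemma MemX.smul {S : Profile Ω} {u : E3 → ℂ} {g : E3 → C3} (c : ℂ) (hu : MemX S u g) :
    MemX S (fun x => c * u x) (fun x => c • g x) where
  memLp r hr := (hu.memLp r hr).const_mul c
  memLp_grad r hr := (hu.memLp_grad r hr).const_smul c
  weakGradient φ hφ hc hs i := by
    have a1 := hu.weakGradient φ hφ hc hs i
    simp only [PiLp.smul_apply, smul_eq_mul, mul_left_comm _ c]
    rw [integral_const_mul, integral_const_mul, a1, mul_neg]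
  trace r hr δ hδ := by
    obtain ⟨η, hη, hlt⟩ : ∃ η : ℝ≥0∞, 0 < η ∧ ∀ t, t < η → ‖c‖ₑ * t < δ := by
      by_cases hc : c = 0
      · exact ⟨1, one_pos, fun t _ => by simpa [hc] using hδ⟩
      · have hc0 : ‖c‖ₑ ≠ 0 := by simpa using hc
        refine ⟨δ / ‖c‖ₑ, ENNReal.div_pos hδ.ne' enorm_ne_top, fun t ht => ?_⟩
        rw [mul_comm]
        exact (ENNReal.lt_div_iff_mul_lt (Or.inl hc0) (Or.inl enorm_ne_top)).1 ht
    obtain ⟨φ, s1, k1, a1, b1, t1⟩ := hu.trace r hr _ hη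
    refine ⟨fun x => c * φ x, contDiff_const.mul s1, k1.mul_left, ?_, ?_, ?_⟩
    · convert hlt _ a1 using 1
      rw [← eLpNorm_const_smul]
      congr 1
      funext x; simp only [Pi.smul_apply, smul_eq_mul]; ring
    · convert hlt _ b1 using 1
      rw [← eLpNorm_const_smul]
      congr 1
      funext x
      have : grad (fun x => c * φ x) x = c • grad φ x := by
        ext i
        simp only [grad, PiLp.smul_apply]
        rw [fderiv_const_mul (s1.differentiable (by simp) x)]
        rfl
      rw [this, Pi.smul_apply, smul_sub]
    · convert hlt _ t1 using 1
      rw [← eLpNorm_const_smul]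
      congr 1
      funext x; simp
  finite_grad := by
    refine (hu.finite_grad.const_mul (‖c‖ ^ 2)).congr (ae_of_all _ fun x => ?_)
    simp only [map_smul, inner_smul_left, inner_smul_right]
    rw [← mul_assoc, mul_comm c, RCLike.conj_mul, ← RCLike.ofReal_pow, RCLike.re_ofReal_mul]
  finite := by
    refine (hu.finite.const_mul (‖c‖ ^ 2)).congr (ae_of_all _ fun x => ?_)
    simp only [norm_mul, mul_pow]
    ring

lemma MemX.zero {S : Profile Ω} : MemX S (fun _ => 0) (fun _ => 0) where
  memLp _ _ := MemLp.zero'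
  memLp_grad _ _ := MemLp.zero'
  weakGradient φ hφ hc hs i := by simp
  trace r hr δ hδ := ⟨fun _ => 0, contDiff_const, HasCompactSupport.zero, by simpa using hδ, by
    have : (fun x => grad (fun _ => (0 : ℂ)) x - (0 : C3)) = fun _ => 0 := by
      funext x; ext i; simp [grad]
    rw [this]; simpa using hδ, by simpa using hδ⟩
  finite_grad := by simp
  finite := by simp

lemma MemX.congr {S : Profile Ω} {u v : E3 → ℂ} {g h : E3 → C3} (hu : MemX S u g)
    (huv : u =ᵐ[volume.restrict Ω] v) (hgh : g =ᵐ[volume.restrict Ω] h) : MemX S v h := by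
  have mono : ∀ r : ℝ, volume.restrict (Ω ∩ Metric.ball (0 : E3) r) ≤ volume.restrict Ω :=
    fun r => Measure.restrict_mono inter_subset_left le_rfl
  have huv' : ∀ r : ℝ, u =ᵐ[volume.restrict (Ω ∩ Metric.ball (0 : E3) r)] v :=
    fun r => ae_mono (mono r) huv
  have hgh' : ∀ r : ℝ, g =ᵐ[volume.restrict (Ω ∩ Metric.ball (0 : E3) r)] h :=
    fun r => ae_mono (mono r) hgh
  refine ⟨fun r hr => (hu.memLp r hr).ae_eq (huv' r),
    fun r hr => (hu.memLp_grad r hr).ae_eq (hgh' r), ?_, ?_, ?_, ?_⟩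
  · intro φ hφ hc hs i
    have a1 := hu.weakGradient φ hφ hc hs i
    have e1 : ∫ x in Ω, ((fderiv ℝ φ x (e i) : ℝ) : ℂ) * u x
        = ∫ x in Ω, ((fderiv ℝ φ x (e i) : ℝ) : ℂ) * v x :=
      integral_congr_ae (huv.mono fun x hx => by simp only [hx])
    have e2 : ∫ x in Ω, ((φ x : ℝ) : ℂ) * g x i = ∫ x in Ω, ((φ x : ℝ) : ℂ) * h x i :=
      integral_congr_ae (hgh.mono fun x hx => by simp only [hx])
    rw [← e1, ← e2, a1]
  · intro r hr δ hδ
    obtain ⟨φ, s1, k1, a1, b1, t1⟩ := hu.trace r hr _ hδ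
    refine ⟨φ, s1, k1, ?_, ?_, t1⟩
    · rwa [eLpNorm_congr_ae (g := fun x => φ x - v x)
        ((huv' r).mono fun x hx => by simp only [hx])] at a1
    · rwa [eLpNorm_congr_ae (g := fun x => grad φ x - h x)
        ((hgh' r).mono fun x hx => by simp only [hx])] at b1
  · exact hu.finite_grad.congr (hgh.mono fun x hx => by simp only [hx])
  · exact hu.finite.congr (huv.mono fun x hx => by simp only [hx])

end Facts

/-- The space `X` as a subspace of the space of pairs of (almost everywhere classes of) measurable
functions on `Ω`: an element consists of a function and its weak gradient, which the function
determines uniquely. -/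
def XSub {Ω : Set E3} (S : Profile Ω) :
    Submodule ℂ ((E3 →ₘ[volume.restrict Ω] ℂ) × (E3 →ₘ[volume.restrict Ω] C3)) where
  carrier := {p | MemX S p.1 p.2}
  zero_mem' := MemX.zero.congr AEEqFun.coeFn_zero.symm AEEqFun.coeFn_zero.symm
  add_mem' {p q} hp hq :=
    (MemX.add hp hq p.1.aestronglyMeasurable q.1.aestronglyMeasurable
      p.2.aestronglyMeasurable q.2.aestronglyMeasurable).congr
      (AEEqFun.coeFn_add p.1 q.1).symm (AEEqFun.coeFn_add p.2 q.2).symm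
  smul_mem' c p hp :=
    (MemX.smul c hp).congr (AEEqFun.coeFn_smul c p.1).symm (AEEqFun.coeFn_smul c p.2).symm

/-- The space `X = X(Ω)` of the scaled problem. -/
def X {Ω : Set E3} (S : Profile Ω) : Type := XSub S

namespace X

variable {Ω : Set E3} {S : Profile Ω}

instance : AddCommGroup (X S) := inferInstanceAs (AddCommGroup (XSub S))

instance : Module ℂ (X S) := inferInstanceAs (Module ℂ (XSub S))

/-- The function underlying an element of `X`. -/
def val (u : X S) : E3 → ℂ := (Subtype.val u).1

/-- The weak gradient of an element of `X`. -/
def nabla (u : X S) : E3 → C3 := (Subtype.val u).2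

lemma memX (u : X S) : MemX S u.val u.nabla := Subtype.property u

lemma meas_val (u : X S) : AEStronglyMeasurable u.val (volume.restrict Ω) :=
  (Subtype.val u).1.aestronglyMeasurable

lemma meas_nabla (u : X S) : AEStronglyMeasurable u.nabla (volume.restrict Ω) :=
  (Subtype.val u).2.aestronglyMeasurable

lemma val_add (u v : X S) : (u + v).val =ᵐ[volume.restrict Ω] fun x => u.val x + v.val x :=
  AEEqFun.coeFn_add _ _

lemma nabla_add (u v : X S) :
    (u + v).nabla =ᵐ[volume.restrict Ω] fun x => u.nabla x + v.nabla x :=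
  AEEqFun.coeFn_add _ _

lemma val_smul (c : ℂ) (u : X S) : (c • u).val =ᵐ[volume.restrict Ω] fun x => c * u.val x :=
  AEEqFun.coeFn_smul _ _

lemma nabla_smul (c : ℂ) (u : X S) :
    (c • u).nabla =ᵐ[volume.restrict Ω] fun x => c • u.nabla x :=
  AEEqFun.coeFn_smul _ _

lemma eq_zero_of_ae (u : X S) (h1 : u.val =ᵐ[volume.restrict Ω] fun _ => 0)
    (h2 : u.nabla =ᵐ[volume.restrict Ω] fun _ => 0) : u = 0 :=
  Subtype.ext (Prod.ext (AEEqFun.ext (h1.trans AEEqFun.coeFn_zero.symm))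
    (AEEqFun.ext (h2.trans AEEqFun.coeFn_zero.symm)))

/-- The integrand of the scalar product of `X`, with Mathlib's convention that the first argument
is the conjugated one: `((|d̃² d⁻¹| P + |d| (I - P)) ∇v) · conj (∇u) + |d̃² d| v conj u` -/
def density (u v : X S) (x : E3) : ℂ :=
  ⟪u.nabla x, S.W x (v.nabla x)⟫_ℂ + (S.w x : ℂ) * ((starRingEnd ℂ) (u.val x) * v.val x)

lemma integrable_density (u v : X S) : IntegrableOn (density u v) Ω :=
  (integrable_inner_W S v.meas_nabla u.meas_nabla v.memX.finite_grad u.memX.finite_grad).add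
    (integrable_w_mul S v.meas_val u.meas_val v.memX.finite u.memX.finite)

lemma re_density_self (u : X S) (x : E3) : RCLike.re (density u u x)
    = RCLike.re ⟪u.nabla x, S.W x (u.nabla x)⟫_ℂ + S.w x * ‖u.val x‖ ^ 2 := by
  rw [density, map_add, RCLike.conj_mul]
  congr 1
  rw [← RCLike.ofReal_pow]
  exact RCLike.re_ofReal_mul _ _

lemma re_density_self_nonneg (u : X S) (x : E3) : 0 ≤ RCLike.re (density u u x) := by
  rw [re_density_self]
  have := re_inner_W_nonneg S x (u.nabla x)
  have hw : 0 ≤ S.w x := zero_le_one.trans (one_le_w S x)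
  positivity

/-- The scalar product of `X`. -/
@[reducible] def core : InnerProductSpace.Core ℂ (X S) where
  inner u v := ∫ x in Ω, density u v x
  conj_inner_symm u v := by
    rw [← integral_conj]
    refine integral_congr_ae (ae_of_all _ fun x => ?_)
    simp only [density, map_add, map_mul, inner_W_symm, Complex.conj_ofReal, Complex.conj_conj]
    ring
  re_inner_nonneg u := by
    have h : ∫ x in Ω, RCLike.re (density u u x) = RCLike.re (∫ x in Ω, density u u x) :=
      integral_re (integrable_density u u)
    rw [← h]
    exact integral_nonneg fun x => re_density_self_nonneg u x
  add_left u v z := by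
    rw [← integral_add (integrable_density u z) (integrable_density v z)]
    refine integral_congr_ae ?_
    filter_upwards [val_add u v, nabla_add u v] with x h1 h2
    simp only [density, h1, h2, inner_add_left, map_add]
    ring
  smul_left u v c := by
    rw [← integral_const_mul]
    refine integral_congr_ae ?_
    filter_upwards [val_smul c u, nabla_smul c u] with x h1 h2
    simp only [density, h1, h2, inner_smul_left, map_mul]
    ring
  definite u hu := by
    have h : ∫ x in Ω, RCLike.re (density u u x) = RCLike.re (∫ x in Ω, density u u x) :=
      integral_re (integrable_density u u)
    have h0 : ∫ x in Ω, RCLike.re (density u u x) = 0 := by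
      rw [h]
      exact (congrArg RCLike.re hu).trans (map_zero _)
    have h1 := (integral_eq_zero_iff_of_nonneg (fun x => re_density_self_nonneg u x)
      (integrable_density u u).re).1 h0
    refine eq_zero_of_ae u ?_ ?_
    · filter_upwards [h1] with x hx
      have hx' : RCLike.re (density u u x) = 0 := hx
      rw [re_density_self] at hx'
      have a := re_inner_W_nonneg S x (u.nabla x)
      have hw := one_le_w S x
      have : S.w x * ‖u.val x‖ ^ 2 = 0 := by
        have : 0 ≤ S.w x * ‖u.val x‖ ^ 2 := by positivity
        linarith
      have := (mul_eq_zero.1 this).resolve_left (by positivity)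
      simpa using this
    · filter_upwards [h1] with x hx
      have hx' : RCLike.re (density u u x) = 0 := hx
      rw [re_density_self] at hx'
      have a := re_inner_W_nonneg S x (u.nabla x)
      have hw := one_le_w S x
      refine eq_zero_of_re_inner_W S x _ ?_
      have : 0 ≤ S.w x * ‖u.val x‖ ^ 2 := by positivity
      linarith

instance : NormedAddCommGroup (X S) := core.toNormedAddCommGroup

instance : InnerProductSpace ℂ (X S) := InnerProductSpace.ofCore core.toCore

lemma inner_def (u v : X S) : ⟪u, v⟫_ℂ = ∫ x in Ω, density u v x := rfl

end X

/-! ### The symbol of the multiplication operator -/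

/-- The argument with values in `[-π, π)` -/
def arg' (z : ℂ) : ℝ := if Complex.arg z = Real.pi then -Real.pi else Complex.arg z

/-- The symbol `η` (which depends on `ω`) as a function of the radius. -/
def Profile.symbol {Ω : Set E3} (S : Profile Ω) (ω : ℂ) (r : ℝ) : ℂ :=
  if arg' (-ω ^ 2 * S.d₀ ^ 2) < 0 then
    (starRingEnd ℂ) ((‖S.dh r‖ : ℂ) / S.dh r)
  else
    (starRingEnd ℂ) (S.dh r / S.dt r ^ 2 * ((‖S.dt r‖ : ℂ) ^ 2 / (‖S.dh r‖ : ℂ)))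

/-- `ηε` is a smoothing, with accuracy `ε`, of the function `η` on `[r₁, ∞)`, extended to `[0, r₁]`
by the constant `ηε r₁`. -/
structure IsSmoothing (r₁ ε : ℝ) (η ηε : ℝ → ℂ) : Prop where
  close : eLpNorm (fun r => η r - ηε r) ⊤ (volume.restrict (Ioi r₁)) < ENNReal.ofReal ε
  left : ∃ a, r₁ < a ∧ ∀ r, r₁ ≤ r → r ≤ a → ηε r = η r₁
  right : ∃ (b : ℝ) (l : ℂ), r₁ < b ∧ Tendsto η atTop (𝓝 l) ∧ ∀ r, b ≤ r → ηε r = l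
  smooth : ContDiffOn ℝ (⊤ : ℕ∞) ηε (Ici r₁)
  inside : ∀ r, 0 ≤ r → r ≤ r₁ → ηε r = ηε r₁

/-- The operator `T` on `X` is the multiplication by the radial function `η(|x|)`. -/
def IsRadialMul {Ω : Set E3} {S : Profile Ω} (η : ℝ → ℂ) (T : X S →L[ℂ] X S) : Prop :=
  ∀ u : X S, (T u).val =ᵐ[volume.restrict Ω] fun x => η ‖x‖ * u.val x

/-! ### Approximation by finite dimensional subspaces -/

/-- The norm of `H¹(D)` for a function `u` with weak gradient `g` -/
def normH1 (D : Set E3) (u : E3 → ℂ) (g : E3 → C3) : ℝ :=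
  √(∫ x in D, (‖u x‖ ^ 2 + ‖g x‖ ^ 2))

/-- `G` holds square integrable second weak derivatives on `D` of a function with weak gradient
`g`: `G i` is the weak gradient of the `i`-th component of `g`. -/
def IsWeakHessian (D : Set E3) (g : E3 → C3) (G : Fin 3 → E3 → C3) : Prop :=
  ∀ i, IsWeakGradient D (fun x => g x i) (G i) ∧ MemLp (G i) 2 (volume.restrict D)

/-- The norm of `H²(D)` for a function `u` with weak gradient `g` and weak Hessian `G` -/
def normH2 (D : Set E3) (u : E3 → ℂ) (g : E3 → C3) (G : Fin 3 → E3 → C3) : ℝ :=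
  √(∫ x in D, (‖u x‖ ^ 2 + ‖g x‖ ^ 2 + ∑ i, ‖G i x‖ ^ 2))

/-- The bounded operators `Π n` are projections onto the spaces `Xh n` that act locally, with
respect to the widths `h n → 0`: the values of `Π n u` on a ball of radius `h n` depend only on
the values of `u` on the concentric ball of radius `R * h n`, and on every compact part of `Ω`, as
soon as `n` is large, `Π n` approximates as follows,
`‖u - Π n u‖_{H¹(B_{h n}(x₀))} ≤ C₁ (h n)^(s-1) ‖u‖_{Hˢ(B_{R h n}(x₀))}` for `s = 1, 2`. -/
structure IsLocalProjection {Ω : Set E3} {S : Profile Ω} (Xh : ℕ → Submodule ℂ (X S))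
    (h : ℕ → ℝ) (P : ∀ n, X S →L[ℂ] Xh n) : Prop where
  h_pos : ∀ n, 0 < h n
  h_lim : Tendsto h atTop (𝓝 0)
  proj : ∀ n (v : Xh n), P n v = v
  acts_locally : ∃ C₁ R : ℝ, 1 < C₁ ∧ 1 < R ∧
    (∀ n, ∀ x₀ ∈ Ω, ∀ u : X S,
      (∀ᵐ x ∂volume.restrict (Ω ∩ Metric.ball x₀ (R * h n)), u.val x = 0) →
      ∀ᵐ x ∂volume.restrict (Ω ∩ Metric.ball x₀ (h n)), (P n u : X S).val x = 0) ∧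
    ∀ D ⊆ Ω, IsCompact D → ∃ n₀ : ℕ, ∀ n > n₀, ∀ x₀, Metric.ball x₀ (R * h n) ⊆ D →
      ∀ u : X S,
        normH1 (Metric.ball x₀ (h n)) (u - P n u).val (u - P n u).nabla
            ≤ C₁ * normH1 (Metric.ball x₀ (R * h n)) u.val u.nabla ∧
        ∀ G, IsWeakHessian (Metric.ball x₀ (R * h n)) u.nabla G →
          normH1 (Metric.ball x₀ (h n)) (u - P n u).val (u - P n u).nabla
            ≤ C₁ * h n * normH2 (Metric.ball x₀ (R * h n)) u.val u.nabla G

/-- On each compact part of `Ω` the constant function `1` is attained in `Xh n` for all large `n`. -/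
def HasLocalConstants {Ω : Set E3} {S : Profile Ω} (Xh : ℕ → Submodule ℂ (X S)) : Prop :=
  ∀ D ⊆ Ω, IsCompact D → ∃ n₀ : ℕ, ∀ n > n₀, ∃ u ∈ Xh n,
    ∀ᵐ x ∂volume.restrict D, u.val x = 1

/-- `T` is a Fredholm operator with index zero. -/
def IsFredholmIndexZero {V : Type*} [NormedAddCommGroup V] [NormedSpace ℂ V] (T : V →L[ℂ] V) :
    Prop :=
  T.IsFredholm ∧ Module.finrank ℂ T.ker = Module.finrank ℂ (V ⧸ T.range)

/-- The discrete norm `sup_{v ∈ V, v ≠ 0} ‖A v‖ / ‖v‖` of an operator on a subspace `V` of `H`. -/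
def discreteNorm {H : Type*} [NormedAddCommGroup H] [InnerProductSpace ℂ H] {V : Submodule ℂ H}
    (A : V →L[ℂ] H) : ℝ≥0∞ :=
  ⨆ v : V, ⨆ _ : v ≠ 0, ‖A v‖ₑ / ‖v‖ₑ

/-- The discrete operator `P T|_V` on `V` for `P : H → V` -/
def galerkin {H : Type*} [NormedAddCommGroup H] [InnerProductSpace ℂ H] {V : Submodule ℂ H}
    (P : H →L[ℂ] V) (T : H →L[ℂ] H) : V →L[ℂ] V :=
  P ∘L T ∘L V.subtypeL

end PML

end

/-!
The theorem is an instance of the discrete commutator property of local projections. The symbol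
`m(x) = ηε(|x|)` is a smooth function: `ηε` is constant up to some `a > r₁`, which takes care of the
origin and of the start of the scaling, and it is constant again from some `b` on. So `∇m` is
supported in a compact annulus inside `Ω`, on which the weights of `X` are bounded from above and
from below, and multiplication by `m` is a bounded operator `T` on `X` (`IsMultiplier.mulOp`). The
Galerkin operators act on finite dimensional spaces, hence are Fredholm with index zero.

It remains to estimate `(1 - P) (m u)` for `u` in the range `V` of a local projection `P` of width
`h`, uniformly in `u`. On a ball where `m` is constant this vanishes, by locality and because
`(1 - P) u = 0` (`IsMultiplier.commutator_ae_eq_zero`). On a ball around `x₀` inside the annulus,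
let `c` be the mean value of `u` on the concentric ball of radius `R h`, and write
`m u = m(x₀) u + (m - m(x₀)) (u - c) + c (m - m(x₀))`. The projection reproduces the first term. The
second one is of order `h` in `H¹`, because `m - m(x₀)` is of order `h` and so is `u - c` in `L²`,
by the Poincaré inequality. The third one is smooth, and approximation of second order gains a factor
`h`. This is `IsMultiplier.energy_commutator_le`. Averaging over all centres `x₀`, by Fubini's
theorem, turns the local estimates into a global one (`setLIntegral_le_of_ball_le`), whence the
commutator has discrete norm `O(h)` (`IsMultiplier.eventually_commutator_le`).

The Poincaré inequality on balls is proved for smooth functions in `poincare_of_contDiff`. It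
extends to `X` because the definition of traces provides approximations by smooth functions in `H¹` of
bounded parts of `Ω`.
-/

namespace PML

/-! ### The Poincaré inequality on balls -/

lemma eLpNorm_two_sq {α F : Type*} [MeasurableSpace α] [NormedAddCommGroup F]
    (μ : Measure α) (f : α → F) : eLpNorm f 2 μ ^ 2 = ∫⁻ x, ‖f x‖ₑ ^ 2 ∂μ := by
  have := eLpNorm_nnreal_pow_eq_lintegral (f := f) (μ := μ) (p := 2) (by norm_num)
  simpa using this

lemma enorm_integral_sq_le {α F : Type*} [MeasurableSpace α] [NormedAddCommGroup F]
    [NormedSpace ℝ F] {μ : Measure α} {f : α → F} (hf : AEStronglyMeasurable f μ) :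
    ‖∫ x, f x ∂μ‖ₑ ^ 2 ≤ μ univ * ∫⁻ x, ‖f x‖ₑ ^ 2 ∂μ := by
  have h1 : ‖∫ x, f x ∂μ‖ₑ ≤ eLpNorm f 1 μ := by
    rw [eLpNorm_one_eq_lintegral_enorm]; exact enorm_integral_le_lintegral_enorm f
  have h2 := eLpNorm_le_eLpNorm_mul_rpow_measure_univ (p := 1) (q := 2) (by norm_num) hf
  calc ‖∫ x, f x ∂μ‖ₑ ^ 2 ≤ (eLpNorm f 2 μ * μ univ ^ (1 / (1 : ℝ≥0∞).toReal
        - 1 / (2 : ℝ≥0∞).toReal)) ^ 2 := by gcongr; exact h1.trans h2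
    _ = μ univ * ∫⁻ x, ‖f x‖ₑ ^ 2 ∂μ := by
      rw [mul_pow, eLpNorm_two_sq, mul_comm, ← ENNReal.rpow_natCast (μ univ ^ _),
        ← ENNReal.rpow_mul]
      norm_num

/-- The square of a mean value, times the volume, is at most the integral of the square. -/
lemma enorm_average_sq_mul_le {α F : Type*} [MeasurableSpace α] [NormedAddCommGroup F]
    [NormedSpace ℝ F] {μ : Measure α} {f : α → F} (hμ : μ univ ≠ 0) (hμ' : μ univ ≠ ⊤)
    (hf : AEStronglyMeasurable f μ) :
    ‖⨍ x, f x ∂μ‖ₑ ^ 2 * μ univ ≤ ∫⁻ x, ‖f x‖ₑ ^ 2 ∂μ := by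
  rw [average_eq, enorm_smul, mul_pow]
  have : ‖(μ.real univ)⁻¹‖ₑ = (μ univ)⁻¹ := by
    rw [Real.enorm_of_nonneg (by positivity), ENNReal.ofReal_inv_of_pos, Measure.real,
      ENNReal.ofReal_toReal hμ']
    exact ENNReal.toReal_pos hμ hμ'
  rw [this]
  calc _ ≤ ((μ univ)⁻¹ ^ 2 * (μ univ * ∫⁻ x, ‖f x‖ₑ ^ 2 ∂μ)) * μ univ := by
        gcongr; exact enorm_integral_sq_le hf
    _ = ((μ univ)⁻¹ * μ univ) ^ 2 * ∫⁻ x, ‖f x‖ₑ ^ 2 ∂μ := by ring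
    _ = _ := by rw [ENNReal.inv_mul_cancel hμ hμ']; simp

lemma ennreal_add_sq_le (a b : ℝ≥0∞) : (a + b) ^ 2 ≤ 2 * a ^ 2 + 2 * b ^ 2 := by
  induction a with
  | top => simp
  | coe a =>
    induction b with
    | top => simp
    | coe b => exact_mod_cast (add_sq_le (a := a) (b := b)).trans_eq (mul_add _ _ _)

lemma enorm_add_sq_le {F : Type*} [NormedAddCommGroup F] (a b : F) :
    ‖a + b‖ₑ ^ 2 ≤ 2 * ‖a‖ₑ ^ 2 + 2 * ‖b‖ₑ ^ 2 :=
  (pow_le_pow_left' (enorm_add_le a b) 2).trans (ennreal_add_sq_le _ _)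

lemma enorm_sub_sq_le_lintegral_fderiv {E V : Type*} [NormedAddCommGroup E] [NormedSpace ℝ E]
    [NormedAddCommGroup V] [NormedSpace ℝ V] [CompleteSpace V] {φ : E → V}
    (hφ : ContDiff ℝ 1 φ) (x v : E) :
    ‖φ (x + v) - φ x‖ₑ ^ 2
      ≤ ‖v‖ₑ ^ 2 * ∫⁻ s in Ioc (0 : ℝ) 1, ‖fderiv ℝ φ (x + s • v)‖ₑ ^ 2 := by
  have hc : Continuous fun s : ℝ => fderiv ℝ φ (x + s • v) v :=
    ((hφ.continuous_fderiv (by simp)).comp (by fun_prop)).clm_apply continuous_const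
  have h1 : ∫ s in (0 : ℝ)..1, fderiv ℝ φ (x + s • v) v = φ (x + v) - φ x := by
    rw [intervalIntegral.integral_eq_sub_of_hasDerivAt (f := fun s : ℝ => φ (x + s • v))]
    · simp
    · intro s _
      have h2 : HasDerivAt (fun s : ℝ => x + s • v) v s := by
        simpa using ((hasDerivAt_id s).smul_const v).const_add x
      exact (hφ.differentiable (by simp) _).hasFDerivAt.comp_hasDerivAt s h2
    · exact hc.intervalIntegrable _ _
  rw [← h1, intervalIntegral.integral_of_le zero_le_one]
  refine (enorm_integral_sq_le hc.aestronglyMeasurable).trans ?_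
  rw [Measure.restrict_apply_univ, Real.volume_Ioc, sub_zero, ENNReal.ofReal_one, one_mul,
    ← lintegral_const_mul' _ _ (by simp)]
  refine lintegral_mono fun s => ?_
  rw [← mul_pow, mul_comm]
  gcongr
  exact ContinuousLinearMap.le_opENorm _ _

section Poincare

variable {E : Type*} [NormedAddCommGroup E] [NormedSpace ℝ E] [FiniteDimensional ℝ E]
  [MeasurableSpace E] [BorelSpace E]

/-- Contracting a convex set towards one of its points, by a factor of at least `1/2`, increases
integrals of nonnegative functions at most by the factor `2 ^ dim`. -/
lemma setLIntegral_comp_contraction_le (μ : Measure E) [μ.IsAddHaarMeasure] {B : Set E}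
    (hB : Convex ℝ B) (hBm : MeasurableSet B) {y : E} (hy : y ∈ B) {t : ℝ} (ht0 : 0 ≤ t)
    (ht : t ≤ 1 / 2) {F : E → ℝ≥0∞} (hF : Measurable F) :
    ∫⁻ x in B, F (x + t • (y - x)) ∂μ ≤ 2 ^ Module.finrank ℝ E * ∫⁻ x in B, F x ∂μ := by
  have hl : (1 - t) ≠ 0 := by linarith
  set G := B.indicator F
  have hG : Measurable G := hF.indicator hBm
  have e1 : ∀ x, x + t • (y - x) = (1 - t) • x + t • y := fun x => by module
  calc ∫⁻ x in B, F (x + t • (y - x)) ∂μ ≤ ∫⁻ x, G ((1 - t) • x + t • y) ∂μ := by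
        rw [← lintegral_indicator hBm]
        refine lintegral_mono fun x => ?_
        by_cases hx : x ∈ B
        · have : (1 - t) • x + t • y ∈ B := hB hx hy (by linarith) ht0 (by ring)
          simp only [indicator_of_mem hx, G, indicator_of_mem this, e1, le_refl]
        · simp [indicator_of_notMem hx]
    _ = ∫⁻ x, G (x + t • y) ∂(Measure.map ((1 - t) • ·) μ) := by
        rw [lintegral_map (f := fun x => G (x + t • y)) (hG.comp (measurable_add_const _))
          (measurable_const_smul _)]
    _ = ENNReal.ofReal |((1 - t) ^ Module.finrank ℝ E)⁻¹| * ∫⁻ x in B, F x ∂μ := by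
        rw [Measure.map_addHaar_smul μ hl, lintegral_smul_measure,
          lintegral_add_right_eq_self G, lintegral_indicator hBm, smul_eq_mul]
    _ ≤ _ := by
        gcongr
        have h2 : |((1 - t) ^ Module.finrank ℝ E)⁻¹| ≤ 2 ^ Module.finrank ℝ E := by
          rw [abs_of_nonneg (inv_nonneg.2 (pow_nonneg (by linarith) _)), ← inv_pow]
          refine pow_le_pow_left₀ (inv_nonneg.2 (by linarith)) ?_ _
          rw [inv_le_comm₀ (by linarith) (by norm_num)]; linarith
        calc _ ≤ ENNReal.ofReal (2 ^ Module.finrank ℝ E) := ENNReal.ofReal_le_ofReal h2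
          _ = _ := by rw [ENNReal.ofReal_pow (by norm_num)]; simp

variable {V : Type*} [NormedAddCommGroup V] [NormedSpace ℝ V] [CompleteSpace V]

/-- The Poincaré inequality for smooth functions on a ball of radius `ρ`. The function minus its
mean is bounded by the double integral of `|φ(x) - φ(y)|²`, and this difference by the derivative
along the two halves of the segment from `x` to `y`. -/
lemma poincare_of_contDiff (μ : Measure E) [μ.IsAddHaarMeasure] {φ : E → V}
    (hφ : ContDiff ℝ 1 φ) (x₀ : E) {ρ : ℝ} (hρ : 0 < ρ) :
    ∫⁻ x in Metric.ball x₀ ρ, ‖φ x - ⨍ y in Metric.ball x₀ ρ, φ y ∂μ‖ₑ ^ 2 ∂μ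
      ≤ 2 ^ (Module.finrank ℝ E + 2) * ENNReal.ofReal ρ ^ 2
        * ∫⁻ x in Metric.ball x₀ ρ, ‖fderiv ℝ φ x‖ₑ ^ 2 ∂μ := by
  set B := Metric.ball x₀ ρ with hBdef
  set n := Module.finrank ℝ E
  set ν := μ.restrict B with hν
  have hBm : MeasurableSet B := measurableSet_ball
  have hBc : Convex ℝ B := convex_ball _ _
  have hν0 : ν univ ≠ 0 := by
    rw [hν, Measure.restrict_apply_univ]; exact (Metric.measure_ball_pos μ x₀ hρ).ne'
  have hνt : ν univ ≠ ⊤ := by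
    rw [hν, Measure.restrict_apply_univ]; exact measure_ball_lt_top.ne
  have : IsFiniteMeasure ν := ⟨hνt.lt_top⟩
  have hcont := hφ.continuous
  have hFm : Measurable fun x => ‖fderiv ℝ φ x‖ₑ ^ 2 :=
    ((hφ.continuous_fderiv (by simp)).enorm.measurable).pow_const 2
  set J := ∫⁻ x, ‖fderiv ℝ φ x‖ₑ ^ 2 ∂ν with hJ
  have hint : Integrable φ ν :=
    (hcont.continuousOn.integrableOn_compact (isCompact_closedBall x₀ ρ)).mono_set
      Metric.ball_subset_closedBall
  -- On the segment from `x` to the midpoint of `x` and `y`, the contraction towards `y` has ratio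
  -- at least `1/2`, so that the change of variables in `x` costs only a dimensional constant.
  have hmid : ∫⁻ x, ∫⁻ y, ‖φ (x + (1 / 2 : ℝ) • (y - x)) - φ x‖ₑ ^ 2 ∂ν ∂ν
      ≤ ENNReal.ofReal ρ ^ 2 * (2 ^ n * (ν univ * J)) := by
    calc ∫⁻ x, ∫⁻ y, ‖φ (x + (1 / 2 : ℝ) • (y - x)) - φ x‖ₑ ^ 2 ∂ν ∂ν
        ≤ ∫⁻ x, ∫⁻ y, ENNReal.ofReal ρ ^ 2 * ∫⁻ s in Ioc (0 : ℝ) 1,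
            ‖fderiv ℝ φ (x + (s / 2) • (y - x))‖ₑ ^ 2 ∂volume ∂ν ∂ν := by
          refine setLIntegral_mono_ae' hBm (ae_of_all _ fun x hx => ?_)
          refine setLIntegral_mono_ae' hBm (ae_of_all _ fun y hy => ?_)
          refine (enorm_sub_sq_le_lintegral_fderiv hφ x _).trans ?_
          have hv : ‖(1 / 2 : ℝ) • (y - x)‖ₑ ≤ ENNReal.ofReal ρ := by
            rw [← ofReal_norm]
            refine ENNReal.ofReal_le_ofReal ?_
            rw [norm_smul, ← dist_eq_norm]
            have h1 := dist_triangle_right y x x₀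
            have h2 := Metric.mem_ball.1 hx
            have h3 := Metric.mem_ball.1 hy
            norm_num
            linarith
          gcongr with s
          rw [smul_smul, mul_one_div]
      _ = ENNReal.ofReal ρ ^ 2 * ∫⁻ s in Ioc (0 : ℝ) 1, ∫⁻ y, ∫⁻ x,
            ‖fderiv ℝ φ (x + (s / 2) • (y - x))‖ₑ ^ 2 ∂ν ∂ν ∂volume := by
          have hm : ∀ x, Measurable fun y => ∫⁻ s in Ioc (0 : ℝ) 1,
              ‖fderiv ℝ φ (x + (s / 2) • (y - x))‖ₑ ^ 2 := by
            intro x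
            refine Measurable.lintegral_prod_right' (f := fun p : E × ℝ =>
              ‖fderiv ℝ φ (x + (p.2 / 2) • (p.1 - x))‖ₑ ^ 2) ?_
            exact hFm.comp (by fun_prop : Continuous fun p : E × ℝ =>
              x + (p.2 / 2) • (p.1 - x)).measurable
          have hm3 : Measurable fun p : (E × E) × ℝ =>
              ‖fderiv ℝ φ (p.1.1 + (p.2 / 2) • (p.1.2 - p.1.1))‖ₑ ^ 2 :=
            hFm.comp (by fun_prop : Continuous fun p : (E × E) × ℝ =>
              p.1.1 + (p.2 / 2) • (p.1.2 - p.1.1)).measurable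
          have e1 : ∀ x, ∫⁻ y, ENNReal.ofReal ρ ^ 2 * ∫⁻ s in Ioc (0 : ℝ) 1,
              ‖fderiv ℝ φ (x + (s / 2) • (y - x))‖ₑ ^ 2 ∂volume ∂ν = ENNReal.ofReal ρ ^ 2 *
              ∫⁻ y, ∫⁻ s in Ioc (0 : ℝ) 1,
                ‖fderiv ℝ φ (x + (s / 2) • (y - x))‖ₑ ^ 2 ∂volume ∂ν :=
            fun x => lintegral_const_mul _ (hm x)
          simp only [e1]
          rw [lintegral_const_mul' _ _ (by simp)]
          congr 1
          rw [lintegral_lintegral (μ := ν) (ν := ν) (f := fun x y => ∫⁻ s in Ioc (0 : ℝ) 1,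
              ‖fderiv ℝ φ (x + (s / 2) • (y - x))‖ₑ ^ 2)
              (hm3.lintegral_prod_right').aemeasurable,
            lintegral_lintegral_swap (f := fun (p : E × E) (s : ℝ) =>
              ‖fderiv ℝ φ (p.1 + (s / 2) • (p.2 - p.1))‖ₑ ^ 2) hm3.aemeasurable]
          refine lintegral_congr fun s => ?_
          rw [lintegral_prod_symm']
          exact hFm.comp (by fun_prop : Continuous fun p : E × E =>
              p.1 + (s / 2) • (p.2 - p.1)).measurable
      _ ≤ ENNReal.ofReal ρ ^ 2 * ∫⁻ s in Ioc (0 : ℝ) 1, ∫⁻ _ : E, 2 ^ n * J ∂ν ∂volume := by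
          gcongr ENNReal.ofReal ρ ^ 2 * ?_
          refine setLIntegral_mono_ae' measurableSet_Ioc (ae_of_all _ fun s hs => ?_)
          refine setLIntegral_mono_ae' hBm (ae_of_all _ fun y hy => ?_)
          exact setLIntegral_comp_contraction_le μ hBc hBm hy (by linarith [hs.1])
            (by linarith [hs.2]) hFm
      _ = _ := by
          simp only [lintegral_const, Measure.restrict_apply_univ, Real.volume_Ioc]
          simp; ring
  have hmean : ∀ x, ‖φ x - ⨍ y, φ y ∂ν‖ₑ ^ 2 * ν univ ≤ ∫⁻ y, ‖φ x - φ y‖ₑ ^ 2 ∂ν := by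
    intro x
    have : φ x - ⨍ y, φ y ∂ν = ⨍ y, (φ x - φ y) ∂ν := by
      have : NeZero ν := ⟨fun h => hν0 (by simp [h])⟩
      have hi := average_const ν (φ x)
      simp only [average_eq] at hi ⊢
      rw [integral_sub (integrable_const _) hint, smul_sub, hi]
    rw [this]
    exact enorm_average_sq_mul_le hν0 hνt (by fun_prop)
  have hsym : ∫⁻ x, ∫⁻ y, ‖φ x - φ y‖ₑ ^ 2 ∂ν ∂ν
      ≤ 4 * ∫⁻ x, ∫⁻ y, ‖φ (x + (1 / 2 : ℝ) • (y - x)) - φ x‖ₑ ^ 2 ∂ν ∂ν := by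
    set M : E → E → ℝ≥0∞ := fun x y => ‖φ (x + (1 / 2 : ℝ) • (y - x)) - φ x‖ₑ ^ 2 with hM
    have hMm : Measurable (Function.uncurry M) :=
      (by fun_prop : Continuous fun p : E × E =>
        ‖φ (p.1 + (1 / 2 : ℝ) • (p.2 - p.1)) - φ p.1‖ₑ ^ 2).measurable
    have hpt : ∀ x y, ‖φ x - φ y‖ₑ ^ 2 ≤ 2 * M x y + 2 * M y x := by
      intro x y
      have e1 : y + (1 / 2 : ℝ) • (x - y) = x + (1 / 2 : ℝ) • (y - x) := by module
      simp only [hM, e1]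
      set m := φ (x + (1 / 2 : ℝ) • (y - x))
      have : φ x - φ y = (m - φ y) + -(m - φ x) := by abel
      rw [this]
      exact (enorm_add_sq_le (m - φ y) (-(m - φ x))).trans_eq
        (by rw [enorm_neg]; exact add_comm _ _)
    calc _ ≤ ∫⁻ x, ∫⁻ y, (2 * M x y + 2 * M y x) ∂ν ∂ν :=
          lintegral_mono fun x => lintegral_mono fun y => hpt x y
      _ = 2 * ∫⁻ x, ∫⁻ y, M x y ∂ν ∂ν + 2 * ∫⁻ x, ∫⁻ y, M y x ∂ν ∂ν := by
          have a1 : ∀ x, Measurable fun y => M x y := fun x => hMm.of_uncurry_left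
          have a2 : ∀ x, Measurable fun y => M y x := fun x => hMm.of_uncurry_right
          rw [← lintegral_const_mul' _ _ (by simp), ← lintegral_const_mul' _ _ (by simp),
            ← lintegral_add_left]
          · refine lintegral_congr fun x => ?_
            rw [lintegral_add_left ((a1 x).const_mul 2), lintegral_const_mul _ (a1 x),
              lintegral_const_mul _ (a2 x)]
          · exact (Measurable.lintegral_prod_right' hMm).const_mul 2
      _ = _ := by
          rw [lintegral_lintegral_swap (f := fun x y => M y x)
            (hMm.comp measurable_swap).aemeasurable, ← add_mul]
          congr 1
          norm_num
  have hfin : (∫⁻ x, ‖φ x - ⨍ y, φ y ∂ν‖ₑ ^ 2 ∂ν) * ν univ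
      ≤ (2 ^ (n + 2) * ENNReal.ofReal ρ ^ 2 * J) * ν univ := by
    calc _ = ∫⁻ x, ‖φ x - ⨍ y, φ y ∂ν‖ₑ ^ 2 * ν univ ∂ν := (lintegral_mul_const' _ _ hνt).symm
      _ ≤ _ := lintegral_mono hmean
      _ ≤ _ := hsym
      _ ≤ 4 * (ENNReal.ofReal ρ ^ 2 * (2 ^ n * (ν univ * J))) := by gcongr
      _ = _ := by ring
  exact (ENNReal.mul_le_mul_iff_left hν0 hνt).1 hfin

end Poincare

/-! ### Gradients of smooth functions -/

lemma continuous_grad {f : E3 → ℂ} (hf : ContDiff ℝ 1 f) : Continuous (grad f) := by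
  have : ∀ i, Continuous fun x => fderiv ℝ f x (e i) := fun i =>
    (hf.continuous_fderiv (by simp)).clm_apply continuous_const
  unfold grad
  fun_prop

lemma grad_mul {f φ : E3 → ℂ} {x : E3} (hf : DifferentiableAt ℝ f x)
    (hφ : DifferentiableAt ℝ φ x) :
    grad (fun x => f x * φ x) x = f x • grad φ x + φ x • grad f x := by
  ext i
  simp only [grad, PiLp.add_apply, PiLp.smul_apply]
  rw [fderiv_fun_mul hf hφ]
  rfl

lemma norm_fderiv_le_norm_grad (φ : E3 → ℂ) (x : E3) : ‖fderiv ℝ φ x‖ ≤ ‖grad φ x‖ := by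
  refine ContinuousLinearMap.opNorm_le_bound _ (norm_nonneg _) fun v => ?_
  have hv : v = ∑ i, v i • e i := by
    ext j
    simp [e, Finset.sum_apply, Pi.single_apply]
  have h1 : fderiv ℝ φ x v = ∑ i, (v i : ℂ) * grad φ x i := by
    conv_lhs => rw [hv]
    simp only [map_sum, map_smul, grad, Complex.real_smul]
  have h2 : fderiv ℝ φ x v = ⟪toC v, grad φ x⟫_ℂ := by
    rw [h1, PiLp.inner_apply]
    refine Finset.sum_congr rfl fun i _ => ?_
    simp [toC, mul_comm]
  rw [h2, mul_comm, ← toC_norm v]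
  exact norm_inner_le_norm _ _

/-- The Poincaré inequality on a ball for limits in `H¹` of smooth functions. -/
lemma poincare_of_approx {u : E3 → ℂ} {g : E3 → C3} {x₀ : E3} {ρ : ℝ} (hρ : 0 < ρ)
    (hu : MemLp u 2 (volume.restrict (Metric.ball x₀ ρ)))
    (hg : AEStronglyMeasurable g (volume.restrict (Metric.ball x₀ ρ)))
    (happ : ∀ δ : ℝ≥0∞, 0 < δ → ∃ φ : E3 → ℂ, ContDiff ℝ 1 φ ∧
      eLpNorm (fun x => φ x - u x) 2 (volume.restrict (Metric.ball x₀ ρ)) < δ ∧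
      eLpNorm (fun x => grad φ x - g x) 2 (volume.restrict (Metric.ball x₀ ρ)) < δ) :
    ∫⁻ x in Metric.ball x₀ ρ, ‖u x - ⨍ y in Metric.ball x₀ ρ, u y‖ₑ ^ 2
      ≤ 64 * ENNReal.ofReal ρ ^ 2 * ∫⁻ x in Metric.ball x₀ ρ, ‖g x‖ₑ ^ 2 := by
  set ν := (volume : Measure E3).restrict (Metric.ball x₀ ρ) with hν
  have hν0 : ν univ ≠ 0 := by
    rw [hν, Measure.restrict_apply_univ]; exact (Metric.measure_ball_pos _ x₀ hρ).ne'
  have hνt : ν univ ≠ ⊤ := by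
    rw [hν, Measure.restrict_apply_univ]; exact measure_ball_lt_top.ne
  have : IsFiniteMeasure ν := ⟨hνt.lt_top⟩
  have : NeZero ν := ⟨fun h => hν0 (by simp [h])⟩
  have hui : Integrable u ν := hu.integrable (by norm_num)
  -- `64 = 8 ^ 2` is a perfect square above the constant `2 ^ (3 + 2)` for smooth functions
  set k : ℝ≥0∞ := 8 * ENNReal.ofReal ρ with hk
  have hkt : k ≠ ⊤ := by finiteness
  have key : ∀ δ : ℝ≥0∞, 0 < δ →
      eLpNorm (fun x => u x - ⨍ y, u y ∂ν) 2 ν ≤ k * (eLpNorm g 2 ν + δ) + (δ + δ) := by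
    intro δ hδ
    obtain ⟨φ, hφ, h1, h2⟩ := happ δ hδ
    have hφi : Integrable φ ν :=
      (hφ.continuous.continuousOn.integrableOn_compact (isCompact_closedBall x₀ ρ)).mono_set
        Metric.ball_subset_closedBall
    have mφ : AEStronglyMeasurable φ ν := hφ.continuous.aestronglyMeasurable
    have mg : AEStronglyMeasurable (grad φ) ν := (continuous_grad hφ).aestronglyMeasurable
    have hsub : (⨍ y, φ y ∂ν) - ⨍ y, u y ∂ν = ⨍ y, (φ y - u y) ∂ν := by
      simp only [average_eq]
      rw [integral_sub hφi hui, smul_sub]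
    have p1 : eLpNorm (fun x => φ x - ⨍ y, φ y ∂ν) 2 ν ≤ k * eLpNorm (grad φ) 2 ν := by
      have hp := poincare_of_contDiff volume hφ x₀ hρ
      rw [← hν] at hp
      have hp2 : eLpNorm (fun x => φ x - ⨍ y, φ y ∂ν) 2 ν ^ 2
          ≤ (k * eLpNorm (grad φ) 2 ν) ^ 2 := by
        rw [eLpNorm_two_sq, mul_pow, eLpNorm_two_sq, hk, mul_pow]
        refine hp.trans ?_
        have h3 : Module.finrank ℝ E3 = 3 := by simp [E3]
        rw [h3]
        refine mul_le_mul' (mul_le_mul' (by norm_num) le_rfl) (lintegral_mono fun x => ?_)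
        refine pow_le_pow_left' ?_ 2
        rw [← ofReal_norm, ← ofReal_norm]
        exact ENNReal.ofReal_le_ofReal (norm_fderiv_le_norm_grad _ _)
      exact (ENNReal.pow_le_pow_left_iff two_ne_zero).1 hp2
    have p2 : eLpNorm (fun _ : E3 => ⨍ y, (φ y - u y) ∂ν) 2 ν
        ≤ eLpNorm (fun x => φ x - u x) 2 ν := by
      refine (ENNReal.pow_le_pow_left_iff two_ne_zero).1 ?_
      rw [eLpNorm_two_sq, eLpNorm_two_sq, lintegral_const]
      exact enorm_average_sq_mul_le hν0 hνt (mφ.sub hu.1)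
    have p3 : eLpNorm (grad φ) 2 ν ≤ eLpNorm g 2 ν + δ := by
      have : grad φ = g + fun x => grad φ x - g x := by funext x; simp
      rw [this]
      exact (eLpNorm_add_le hg (mg.sub hg) (by norm_num)).trans (add_le_add le_rfl h2.le)
    have p4 : (fun x => u x - ⨍ y, u y ∂ν) = (fun x => φ x - ⨍ y, φ y ∂ν)
        + ((fun _ => ⨍ y, (φ y - u y) ∂ν) - fun x => φ x - u x) := by
      funext x
      simp only [Pi.add_apply, Pi.sub_apply, ← hsub]
      ring
    rw [p4]
    refine (eLpNorm_add_le (by fun_prop) ((aestronglyMeasurable_const).sub (mφ.sub hu.1))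
      (by norm_num)).trans (add_le_add (p1.trans (by gcongr)) ?_)
    refine (eLpNorm_sub_le aestronglyMeasurable_const (mφ.sub hu.1) (by norm_num)).trans ?_
    exact add_le_add (p2.trans h1.le) h1.le
  have hfin : eLpNorm (fun x => u x - ⨍ y, u y ∂ν) 2 ν ≤ k * eLpNorm g 2 ν := by
    have hlim : Tendsto (fun δ : ℝ≥0∞ => k * (eLpNorm g 2 ν + δ) + (δ + δ)) (𝓝[>] 0)
        (𝓝 (k * (eLpNorm g 2 ν + 0) + (0 + 0))) := by
      have hid : Tendsto (fun δ : ℝ≥0∞ => δ) (𝓝[>] 0) (𝓝 0) :=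
        tendsto_id.mono_left nhdsWithin_le_nhds
      exact (ENNReal.Tendsto.const_mul (tendsto_const_nhds.add hid) (Or.inr hkt)).add (hid.add hid)
    have := ge_of_tendsto hlim (eventually_nhdsWithin_of_forall fun δ hδ => key δ hδ)
    simpa using this
  calc _ = eLpNorm (fun x => u x - ⨍ y, u y ∂ν) 2 ν ^ 2 := (eLpNorm_two_sq _ _).symm
    _ ≤ (k * eLpNorm g 2 ν) ^ 2 := by gcongr
    _ = _ := by rw [mul_pow, eLpNorm_two_sq, hk, mul_pow]; norm_num

/-! ### Weak gradients -/

lemma integrableOn_complex_test {Ω : Set E3} {u : E3 → ℂ} {ψ : E3 → ℂ} (hψ : Continuous ψ)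
    (hc : HasCompactSupport ψ)
    (hu : ∀ r : ℝ, 0 < r → MemLp u 2 (volume.restrict (Ω ∩ Metric.ball 0 r))) :
    IntegrableOn (fun x => ψ x * u x) Ω := by
  have h1 := integrableOn_test (Complex.continuous_re.comp hψ)
    (hc.comp_left (g := Complex.re) rfl) hu
  have h2 := integrableOn_test (Complex.continuous_im.comp hψ)
    (hc.comp_left (g := Complex.im) rfl) hu
  refine (h1.add (h2.const_mul Complex.I)).congr (ae_of_all _ fun x => ?_)
  simp only [Pi.add_apply, Function.comp]
  conv_rhs => rw [← Complex.re_add_im (ψ x)]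
  ring

lemma memLp_component {μ : Measure E3} {g : E3 → C3} (hg : MemLp g 2 μ) (i : Fin 3) :
    MemLp (fun x => g x i) 2 μ :=
  (EuclideanSpace.proj (𝕜 := ℂ) i : C3 →L[ℂ] ℂ).comp_memLp' hg

lemma IsWeakGradient.mono {Ω B : Set E3} {u : E3 → ℂ} {g : E3 → C3}
    (h : IsWeakGradient Ω u g) (hB : B ⊆ Ω) : IsWeakGradient B u g := by
  intro φ hφ hc hs i
  have z : ∀ x, x ∉ B → φ x = 0 := fun x hx =>
    image_eq_zero_of_notMem_tsupport fun hh => hx (hs hh)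
  have z' : ∀ x, x ∉ B → fderiv ℝ φ x = 0 := fun x hx =>
    image_eq_zero_of_notMem_tsupport fun hh => hx (hs (tsupport_fderiv_subset ℝ hh))
  have a := h φ hφ hc (hs.trans hB) i
  rw [setIntegral_eq_integral_of_forall_compl_eq_zero fun x hx => by
      simp [z' x fun h' => hx (hB h')],
    setIntegral_eq_integral_of_forall_compl_eq_zero fun x hx => by
      simp [z x fun h' => hx (hB h')]] at a
  rw [setIntegral_eq_integral_of_forall_compl_eq_zero fun x hx => by simp [z' x hx],
    setIntegral_eq_integral_of_forall_compl_eq_zero fun x hx => by simp [z x hx], a]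

/-- Weak gradients may be tested with complex valued functions. -/
lemma IsWeakGradient.complex_test {Ω : Set E3} {u : E3 → ℂ} {g : E3 → C3}
    (h : IsWeakGradient Ω u g)
    (hu : ∀ r : ℝ, 0 < r → MemLp u 2 (volume.restrict (Ω ∩ Metric.ball 0 r)))
    (hg : ∀ r : ℝ, 0 < r → MemLp g 2 (volume.restrict (Ω ∩ Metric.ball 0 r)))
    {φ : E3 → ℂ} (hφ : ContDiff ℝ (⊤ : ℕ∞) φ) (hc : HasCompactSupport φ)
    (hs : tsupport φ ⊆ Ω) (i : Fin 3) :
    ∫ x in Ω, fderiv ℝ φ x (e i) * u x = - ∫ x in Ω, φ x * g x i := by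
  have hgi := fun r hr => memLp_component (hg r hr) i
  have part : ∀ A : ℂ →L[ℝ] ℝ, ContDiff ℝ (⊤ : ℕ∞) (fun x => A (φ x)) ∧
      HasCompactSupport (fun x => A (φ x)) ∧ tsupport (fun x => A (φ x)) ⊆ Ω ∧
      ∀ x, fderiv ℝ (fun x => A (φ x)) x (e i) = A (fderiv ℝ φ x (e i)) := by
    intro A
    refine ⟨A.contDiff.comp hφ, hc.comp_left (g := A) (map_zero A),
      (closure_mono (Function.support_comp_subset (map_zero A) φ)).trans hs, fun x => ?_⟩
    have : HasFDerivAt (fun x => A (φ x)) (A.comp (fderiv ℝ φ x)) x :=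
      A.hasFDerivAt.comp x (hφ.differentiable (by simp) x).hasFDerivAt
    rw [this.fderiv]
    rfl
  obtain ⟨s1, c1, t1, d1⟩ := part Complex.reCLM
  obtain ⟨s2, c2, t2, d2⟩ := part Complex.imCLM
  have a1 := h _ s1 c1 t1 i
  have a2 := h _ s2 c2 t2 i
  simp only [d1, d2] at a1 a2
  simp only [Complex.reCLM_apply, Complex.imCLM_apply] at a1 a2
  have cd : Continuous fun x => fderiv ℝ φ x (e i) :=
    (hφ.continuous_fderiv (by simp)).clm_apply continuous_const
  have kd : HasCompactSupport fun x => fderiv ℝ φ x (e i) := hc.fderiv_apply (𝕜 := ℝ) (e i)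
  have split : ∀ {ψ v : E3 → ℂ}, Continuous ψ → HasCompactSupport ψ →
      (∀ r : ℝ, 0 < r → MemLp v 2 (volume.restrict (Ω ∩ Metric.ball 0 r))) →
      ∫ x in Ω, ψ x * v x = (∫ x in Ω, ((ψ x).re : ℂ) * v x)
        + Complex.I * ∫ x in Ω, ((ψ x).im : ℂ) * v x := by
    intro ψ v cψ kψ hv
    have h1 : IntegrableOn (fun x => ((ψ x).re : ℂ) * v x) Ω :=
      integrableOn_test (Complex.continuous_re.comp cψ)
      (kψ.comp_left (g := Complex.re) rfl) hv
    have h2 : IntegrableOn (fun x => ((ψ x).im : ℂ) * v x) Ω :=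
      integrableOn_test (Complex.continuous_im.comp cψ)
      (kψ.comp_left (g := Complex.im) rfl) hv
    rw [← integral_const_mul, ← integral_add h1 (h2.const_mul _)]
    refine integral_congr_ae (ae_of_all _ fun x => ?_)
    dsimp only
    conv_lhs => rw [← Complex.re_add_im (ψ x)]
    ring
  rw [split cd kd hu, split hφ.continuous hc hgi, a1, a2]
  ring

lemma fderiv_ofReal_apply {φ : E3 → ℝ} {x : E3} (hφ : DifferentiableAt ℝ φ x) (v : E3) :
    fderiv ℝ (fun y => (φ y : ℂ)) x v = ((fderiv ℝ φ x v : ℝ) : ℂ) := by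
  have : HasFDerivAt (fun y => (φ y : ℂ)) (Complex.ofRealCLM.comp (fderiv ℝ φ x)) x :=
    Complex.ofRealCLM.hasFDerivAt.comp x hφ.hasFDerivAt
  rw [this.fderiv]
  rfl

/-- The product rule for weak gradients. -/
lemma IsWeakGradient.smooth_mul {Ω : Set E3} {u : E3 → ℂ} {g : E3 → C3}
    (h : IsWeakGradient Ω u g)
    (hu : ∀ r : ℝ, 0 < r → MemLp u 2 (volume.restrict (Ω ∩ Metric.ball 0 r)))
    (hg : ∀ r : ℝ, 0 < r → MemLp g 2 (volume.restrict (Ω ∩ Metric.ball 0 r)))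
    {m : E3 → ℂ} (hm : ContDiff ℝ (⊤ : ℕ∞) m) :
    IsWeakGradient Ω (fun x => m x * u x) (fun x => m x • g x + u x • grad m x) := by
  intro φ hφ hc hs i
  have hgi := fun r hr => memLp_component (hg r hr) i
  set ψ : E3 → ℂ := fun x => (φ x : ℂ) with hψdef
  have hψ : ContDiff ℝ (⊤ : ℕ∞) ψ := Complex.ofRealCLM.contDiff.comp hφ
  have kψ : HasCompactSupport ψ := hc.comp_left (g := Complex.ofReal) rfl
  have sψ : tsupport ψ ⊆ Ω :=
    (closure_mono (Function.support_comp_subset (g := Complex.ofReal) rfl φ)).trans hs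
  have dψ : ∀ x, fderiv ℝ ψ x (e i) = ((fderiv ℝ φ x (e i) : ℝ) : ℂ) := fun x =>
    fderiv_ofReal_apply (hφ.differentiable (by simp) x) (e i)
  have a := h.complex_test hu hg (hψ.mul hm) kψ.mul_right
    ((closure_mono (Function.support_mul_subset_left ψ m)).trans sψ) i
  have dm : ∀ x, fderiv ℝ (fun y => ψ y * m y) x (e i)
      = ψ x * fderiv ℝ m x (e i) + m x * fderiv ℝ ψ x (e i) := by
    intro x
    rw [fderiv_fun_mul (hψ.differentiable (by simp) x) (hm.differentiable (by simp) x)]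
    rfl
  have cd : Continuous fun x => fderiv ℝ ψ x (e i) :=
    (hψ.continuous_fderiv (by simp)).clm_apply continuous_const
  have cm : Continuous fun x => fderiv ℝ m x (e i) :=
    (hm.continuous_fderiv (by simp)).clm_apply continuous_const
  have kd : HasCompactSupport fun x => fderiv ℝ ψ x (e i) := kψ.fderiv_apply (𝕜 := ℝ) (e i)
  have i1 : IntegrableOn (fun x => (ψ x * fderiv ℝ m x (e i)) * u x) Ω :=
    integrableOn_complex_test (hψ.continuous.mul cm) kψ.mul_right hu
  have i2 : IntegrableOn (fun x => (m x * fderiv ℝ ψ x (e i)) * u x) Ω :=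
    integrableOn_complex_test (hm.continuous.mul cd) kd.mul_left hu
  have i3 : IntegrableOn (fun x => (ψ x * m x) * g x i) Ω :=
    integrableOn_complex_test (hψ.continuous.mul hm.continuous) kψ.mul_right hgi
  change ∫ x in Ω, fderiv ℝ (fun y => ψ y * m y) x (e i) * u x
    = - ∫ x in Ω, (ψ x * m x) * g x i at a
  simp only [dm, add_mul] at a
  rw [integral_add i1 i2] at a
  have l1 : ∫ x in Ω, ((fderiv ℝ φ x (e i) : ℝ) : ℂ) * (m x * u x)
      = ∫ x in Ω, (m x * fderiv ℝ ψ x (e i)) * u x :=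
    integral_congr_ae (ae_of_all _ fun x => by simp only [dψ]; ring)
  have l2 : ∫ x in Ω, ((φ x : ℝ) : ℂ) * (m x • g x + u x • grad m x) i
      = (∫ x in Ω, (ψ x * m x) * g x i) + ∫ x in Ω, (ψ x * fderiv ℝ m x (e i)) * u x := by
    rw [← integral_add i3 i1]
    refine integral_congr_ae (ae_of_all _ fun x => ?_)
    simp only [PiLp.add_apply, PiLp.smul_apply, smul_eq_mul, hψdef, grad]
    ring
  rw [l1, l2]
  linear_combination a

/-- A weak gradient vanishes where the function does. -/
lemma IsWeakGradient.ae_eq_zero {Ω U : Set E3} {u : E3 → ℂ} {g : E3 → C3}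
    (h : IsWeakGradient Ω u g) (hU : IsOpen U) (hUΩ : U ⊆ Ω)
    (hg : ∀ r : ℝ, 0 < r → MemLp g 2 (volume.restrict (Ω ∩ Metric.ball 0 r)))
    (hu0 : ∀ᵐ x ∂volume.restrict U, u x = 0) :
    ∀ᵐ x ∂volume.restrict U, g x = 0 := by
  rw [ae_restrict_iff' hU.measurableSet] at hu0 ⊢
  have comp : ∀ i : Fin 3, ∀ᵐ x : E3, x ∈ U → g x i = 0 := by
    intro i
    refine hU.ae_eq_zero_of_integral_contDiff_smul_eq_zero ?_ fun φ hφ hc hs => ?_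
    · refine (locallyIntegrableOn_iff (hU.isLocallyClosed)).2 fun k hk kc => ?_
      obtain ⟨R, hR0, hR⟩ := kc.isBounded.subset_ball_lt 0 0
      have h1 : MemLp (fun x => g x i) 2 (volume.restrict k) :=
        (memLp_component (hg R hR0) i).mono_measure
          (Measure.restrict_mono (subset_inter (hk.trans hUΩ) hR) le_rfl)
      have : IsFiniteMeasure (volume.restrict k) :=
        ⟨by simpa using kc.measure_lt_top⟩
      exact h1.integrable (by norm_num)
    · have a := h φ hφ hc (hs.trans hUΩ) i
      have z : ∫ x in Ω, ((fderiv ℝ φ x (e i) : ℝ) : ℂ) * u x = 0 := by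
        rw [← integral_zero E3 ℂ (μ := volume.restrict Ω)]
        refine integral_congr_ae (ae_restrict_of_ae ?_)
        filter_upwards [hu0] with x hx
        by_cases hxU : x ∈ U
        · simp [hx hxU]
        · have : fderiv ℝ φ x = 0 :=
            image_eq_zero_of_notMem_tsupport fun hh => hxU (hs (tsupport_fderiv_subset ℝ hh))
          simp [this]
      rw [z] at a
      have b : ∫ x in Ω, ((φ x : ℝ) : ℂ) * g x i = ∫ x, ((φ x : ℝ) : ℂ) * g x i :=
        setIntegral_eq_integral_of_forall_compl_eq_zero fun x hx => by
          rw [image_eq_zero_of_notMem_tsupport fun hh => hx (hUΩ (hs hh))]; simp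
      rw [b] at a
      simpa [Complex.real_smul] using a.symm
  filter_upwards [comp 0, comp 1, comp 2] with x h0 h1 h2 hx
  ext i
  fin_cases i
  · exact h0 hx
  · exact h1 hx
  · exact h2 hx

/-- Classical gradients are weak gradients. -/
lemma isWeakGradient_grad {D : Set E3} {f : E3 → ℂ} (hf : ContDiff ℝ 1 f) :
    IsWeakGradient D f (grad f) := by
  intro φ hφ hc hs i
  set ψ : E3 → ℂ := fun x => (φ x : ℂ) with hψdef
  have hψ : ContDiff ℝ (⊤ : ℕ∞) ψ := Complex.ofRealCLM.contDiff.comp hφ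
  have kψ : HasCompactSupport ψ := hc.comp_left (g := Complex.ofReal) rfl
  have dψ : ∀ x, fderiv ℝ ψ x (e i) = ((fderiv ℝ φ x (e i) : ℝ) : ℂ) := fun x =>
    fderiv_ofReal_apply (hφ.differentiable (by simp) x) (e i)
  have cd : Continuous fun x => fderiv ℝ ψ x (e i) :=
    (hψ.continuous_fderiv (by simp)).clm_apply continuous_const
  have kd : HasCompactSupport fun x => fderiv ℝ ψ x (e i) := kψ.fderiv_apply (𝕜 := ℝ) (e i)
  have cf : Continuous fun x => fderiv ℝ f x (e i) :=
    (hf.continuous_fderiv (by simp)).clm_apply continuous_const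
  have z1 : ∀ x, x ∉ D → ψ x = 0 := fun x hx => by
    simp [hψdef, image_eq_zero_of_notMem_tsupport fun hh => hx (hs hh)]
  have z2 : ∀ x, x ∉ D → fderiv ℝ φ x = 0 := fun x hx =>
    image_eq_zero_of_notMem_tsupport fun hh => hx (hs (tsupport_fderiv_subset ℝ hh))
  rw [setIntegral_eq_integral_of_forall_compl_eq_zero fun x hx => by simp [z2 x hx],
    setIntegral_eq_integral_of_forall_compl_eq_zero fun x hx => by
      simpa [hψdef] using Or.inl (z1 x hx)]
  have a := integral_mul_fderiv_eq_neg_fderiv_mul_of_integrable (μ := (volume : Measure E3))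
    (f := f) (g := ψ) (v := e i)
    ((cf.mul hψ.continuous).integrable_of_hasCompactSupport kψ.mul_left)
    ((hf.continuous.mul cd).integrable_of_hasCompactSupport kd.mul_left)
    ((hf.continuous.mul hψ.continuous).integrable_of_hasCompactSupport kψ.mul_left)
    (fun x _ => hf.differentiable (by simp) x) (fun x _ => hψ.differentiable (by simp) x)
  calc _ = ∫ x, f x * fderiv ℝ ψ x (e i) := by
        congr 1; funext x; rw [dψ, mul_comm]
    _ = _ := a
    _ = _ := by congr 2; funext x; simp only [hψdef, grad]; ring

/-! ### Multiplication by smooth functions -/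

section Multiplication

variable {Ω : Set E3} {S : Profile Ω}

lemma re_inner_W_add_le (x : E3) (a b : C3) :
    RCLike.re ⟪a + b, S.W x (a + b)⟫_ℂ
      ≤ 2 * RCLike.re ⟪a, S.W x a⟫_ℂ + 2 * RCLike.re ⟪b, S.W x b⟫_ℂ := by
  have sq : ∀ p q : C3, ‖p + q‖ ^ 2 ≤ 2 * ‖p‖ ^ 2 + 2 * ‖q‖ ^ 2 := fun p q => by
    have h1 := norm_add_le p q
    have h2 := norm_nonneg (p + q)
    nlinarith [sq_nonneg (‖p‖ - ‖q‖)]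
  rw [re_inner_W, re_inner_W, re_inner_W, map_add, add_sub_add_comm]
  have h1 := mul_le_mul_of_nonneg_left (sq (radProj x a) (radProj x b))
    (norm_nonneg (S.dt ‖x‖ ^ 2 * (S.d ‖x‖)⁻¹))
  have h2 := mul_le_mul_of_nonneg_left (sq (a - radProj x a) (b - radProj x b))
    (norm_nonneg (S.d ‖x‖))
  linarith

lemma re_inner_W_smul (x : E3) (c : ℂ) (g : C3) :
    RCLike.re ⟪c • g, S.W x (c • g)⟫_ℂ = ‖c‖ ^ 2 * RCLike.re ⟪g, S.W x g⟫_ℂ := by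
  simp only [map_smul, inner_smul_left, inner_smul_right]
  rw [← mul_assoc, mul_comm c, RCLike.conj_mul, ← RCLike.ofReal_pow, RCLike.re_ofReal_mul]

/-- A smooth function that is bounded together with its gradient, in the Euclidean norm and in the
weighted norm of gradients in `X`. Such functions are multipliers of `X`. -/
structure IsMultiplier (S : Profile Ω) (m : E3 → ℂ) (M L : ℝ) : Prop where
  smooth : ContDiff ℝ (⊤ : ℕ∞) m
  norm_le : ∀ x, ‖m x‖ ≤ M
  norm_grad_le : ∀ x, ‖grad m x‖ ≤ L
  weighted_le : ∀ x, RCLike.re ⟪grad m x, S.W x (grad m x)⟫_ℂ ≤ L ^ 2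

variable {m : E3 → ℂ} {M L : ℝ}

lemma IsMultiplier.re_inner_W_le (hm : IsMultiplier S m M L) (x : E3) (z : ℂ) (g : C3) :
    RCLike.re ⟪m x • g + z • grad m x, S.W x (m x • g + z • grad m x)⟫_ℂ
      ≤ 2 * M ^ 2 * RCLike.re ⟪g, S.W x g⟫_ℂ + 2 * L ^ 2 * (S.w x * ‖z‖ ^ 2) := by
  refine (re_inner_W_add_le x _ _).trans ?_
  rw [re_inner_W_smul, re_inner_W_smul]
  have h0 := re_inner_W_nonneg S x g
  have h1 : ‖m x‖ ^ 2 ≤ M ^ 2 := pow_le_pow_left₀ (norm_nonneg _) (hm.norm_le x) 2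
  have h2 := mul_le_mul_of_nonneg_right h1 h0
  have h3 := mul_le_mul_of_nonneg_left (hm.weighted_le x) (sq_nonneg ‖z‖)
  have h4 := mul_le_mul_of_nonneg_right (one_le_w S x)
    (mul_nonneg (sq_nonneg L) (sq_nonneg ‖z‖))
  nlinarith

lemma IsMultiplier.memX (hm : IsMultiplier S m M L) {u : E3 → ℂ} {g : E3 → C3} (hu : MemX S u g)
    (mu : AEStronglyMeasurable u (volume.restrict Ω))
    (mg : AEStronglyMeasurable g (volume.restrict Ω)) :
    MemX S (fun x => m x * u x) (fun x => m x • g x + u x • grad m x) := by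
  have cm := hm.smooth.continuous
  have cg := continuous_grad (hm.smooth.of_le (by simp))
  have M0 : 0 ≤ M := (norm_nonneg _).trans (hm.norm_le 0)
  have L0 : 0 ≤ L := (norm_nonneg _).trans (hm.norm_grad_le 0)
  have eL : ∀ {F : Type} [NormedAddCommGroup F] [NormedSpace ℂ F] (μ : Measure E3) (v : E3 → F),
      eLpNorm (fun x => m x • v x) 2 μ ≤ ENNReal.ofReal M * eLpNorm v 2 μ := by
    intro F _ _ μ v
    refine eLpNorm_le_mul_eLpNorm_of_ae_le_mul (ae_of_all _ fun x => ?_) 2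
    rw [norm_smul]
    exact mul_le_mul_of_nonneg_right (hm.norm_le x) (norm_nonneg _)
  have eL2 : ∀ (μ : Measure E3) (v : E3 → ℂ),
      eLpNorm (fun x => v x • grad m x) 2 μ ≤ ENNReal.ofReal L * eLpNorm v 2 μ := by
    intro μ v
    refine eLpNorm_le_mul_eLpNorm_of_ae_le_mul (ae_of_all _ fun x => ?_) 2
    rw [norm_smul, mul_comm]
    exact mul_le_mul_of_nonneg_right (hm.norm_grad_le x) (norm_nonneg _)
  have mW : AEStronglyMeasurable (fun x => m x • g x + u x • grad m x) (volume.restrict Ω) :=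
    (cm.aestronglyMeasurable.smul mg).add (mu.smul cg.aestronglyMeasurable)
  refine ⟨fun r hr => ?_, fun r hr => ?_, hu.weakGradient.smooth_mul hu.memLp hu.memLp_grad
    hm.smooth, ?_, ?_, ?_⟩
  · exact ⟨cm.aestronglyMeasurable.mul (hu.memLp r hr).1,
      (eL _ u).trans_lt (ENNReal.mul_lt_top (by simp) (hu.memLp r hr).2)⟩
  · refine MemLp.add ⟨cm.aestronglyMeasurable.smul (hu.memLp_grad r hr).1,
      (eL _ g).trans_lt (ENNReal.mul_lt_top (by simp) (hu.memLp_grad r hr).2)⟩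
      ⟨(hu.memLp r hr).1.smul cg.aestronglyMeasurable,
      (eL2 _ u).trans_lt (ENNReal.mul_lt_top (by simp) (hu.memLp r hr).2)⟩
  · intro r hr δ hδ
    obtain ⟨ε, hε, hlt⟩ : ∃ ε : ℝ≥0∞, 0 < ε ∧ (ENNReal.ofReal M + ENNReal.ofReal L) * ε < δ := by
      have ht : Tendsto (fun ε : ℝ≥0∞ => (ENNReal.ofReal M + ENNReal.ofReal L) * ε) (𝓝[>] 0)
          (𝓝 ((ENNReal.ofReal M + ENNReal.ofReal L) * 0)) :=
        ENNReal.Tendsto.const_mul (tendsto_id.mono_left nhdsWithin_le_nhds)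
          (Or.inr (by finiteness))
      rw [mul_zero] at ht
      exact (eventually_mem_nhdsWithin.and (ht.eventually (gt_mem_nhds hδ))).exists
    obtain ⟨φ, s1, k1, a1, b1, t1⟩ := hu.trace r hr ε hε
    refine ⟨fun x => m x * φ x, hm.smooth.mul s1, k1.mul_left, ?_, ?_, ?_⟩
    · have e1 : (fun x => m x * φ x - m x * u x) = fun x => m x • (φ x - u x) := by
        funext x; simp only [smul_eq_mul]; ring
      rw [e1]
      refine ((eL _ _).trans (mul_le_mul' le_self_add a1.le)).trans_lt hlt
    · have e1 : (fun x => grad (fun x => m x * φ x) x - (m x • g x + u x • grad m x))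
          = (fun x => m x • (grad φ x - g x)) + fun x => (φ x - u x) • grad m x := by
        funext x
        rw [grad_mul (hm.smooth.differentiable (by simp) x) (s1.differentiable (by simp) x)]
        simp only [Pi.add_apply]
        module
      rw [e1]
      have mφ : AEStronglyMeasurable φ (volume.restrict (Ω ∩ Metric.ball 0 r)) :=
        s1.continuous.aestronglyMeasurable
      have mgφ : AEStronglyMeasurable (grad φ) (volume.restrict (Ω ∩ Metric.ball 0 r)) :=
        (continuous_grad (s1.of_le (by simp))).aestronglyMeasurable
      refine (eLpNorm_add_le
        (cm.aestronglyMeasurable.smul (mgφ.sub (hu.memLp_grad r hr).1))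
        ((mφ.sub (hu.memLp r hr).1).smul cg.aestronglyMeasurable) (by norm_num)).trans_lt ?_
      refine lt_of_le_of_lt (add_le_add ((eL _ _).trans (mul_le_mul' le_rfl b1.le))
        ((eL2 _ _).trans (mul_le_mul' le_rfl a1.le))) ?_
      rwa [← add_mul]
    · have e1 : (fun x => m x * φ x - (0 : E3 → ℂ) x)
          = fun x => m x • (φ x - (0 : E3 → ℂ) x) := by
        funext x; simp
      rw [e1]
      refine ((eL _ _).trans (mul_le_mul' le_self_add t1.le)).trans_lt hlt
  · refine ((hu.finite_grad.const_mul (2 * M ^ 2)).add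
      (hu.finite.const_mul (2 * L ^ 2))).mono' ?_ (ae_of_all _ fun x => ?_)
    · exact (RCLike.continuous_re.comp_aestronglyMeasurable
        (mW.inner (aestronglyMeasurable_W S mW)))
    · rw [Real.norm_of_nonneg (re_inner_W_nonneg S x _)]
      exact hm.re_inner_W_le x _ _
  · refine (hu.finite.const_mul (M ^ 2)).mono' ?_ (ae_of_all _ fun x => ?_)
    · exact (measurable_w S).aestronglyMeasurable.mul
        ((cm.aestronglyMeasurable.mul mu).norm.pow 2)
    · have hw : 0 ≤ S.w x := zero_le_one.trans (one_le_w S x)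
      rw [Real.norm_of_nonneg (by positivity), norm_mul, mul_pow]
      have h1 : ‖m x‖ ^ 2 ≤ M ^ 2 := pow_le_pow_left₀ (norm_nonneg _) (hm.norm_le x) 2
      have := mul_le_mul_of_nonneg_right h1 (mul_nonneg hw (sq_nonneg ‖u x‖))
      linarith

namespace X

lemma norm_sq_eq (u : X S) : ‖u‖ ^ 2 = ∫ x in Ω, RCLike.re (density u u x) := by
  rw [@norm_sq_eq_re_inner ℂ, inner_def]
  exact (integral_re (integrable_density u u)).symm

lemma ext_ae {u v : X S} (h1 : u.val =ᵐ[volume.restrict Ω] v.val)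
    (h2 : u.nabla =ᵐ[volume.restrict Ω] v.nabla) : u = v :=
  Subtype.ext (Prod.ext (AEEqFun.ext h1) (AEEqFun.ext h2))

/-- The element of `X` given by a function and its weak gradient. -/
noncomputable def mk (u : E3 → ℂ) (g : E3 → C3) (hu : AEStronglyMeasurable u (volume.restrict Ω))
    (hg : AEStronglyMeasurable g (volume.restrict Ω)) (h : MemX S u g) : X S :=
  (⟨(AEEqFun.mk u hu, AEEqFun.mk g hg),
    h.congr (AEEqFun.coeFn_mk u hu).symm (AEEqFun.coeFn_mk g hg).symm⟩ : XSub S)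

lemma val_mk (u : E3 → ℂ) (g : E3 → C3) (hu : AEStronglyMeasurable u (volume.restrict Ω))
    (hg : AEStronglyMeasurable g (volume.restrict Ω)) (h : MemX S u g) :
    (mk u g hu hg h).val =ᵐ[volume.restrict Ω] u := AEEqFun.coeFn_mk u hu

lemma nabla_mk (u : E3 → ℂ) (g : E3 → C3) (hu : AEStronglyMeasurable u (volume.restrict Ω))
    (hg : AEStronglyMeasurable g (volume.restrict Ω)) (h : MemX S u g) :
    (mk u g hu hg h).nabla =ᵐ[volume.restrict Ω] g := AEEqFun.coeFn_mk g hg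

lemma norm_le_of_density_le {u v : X S} {K : ℝ} (hK : 0 ≤ K)
    (h : ∀ᵐ x ∂volume.restrict Ω, RCLike.re (density u u x) ≤ K ^ 2 * RCLike.re (density v v x)) :
    ‖u‖ ≤ K * ‖v‖ := by
  refine le_of_sq_le_sq ?_ (by positivity)
  rw [mul_pow, norm_sq_eq, norm_sq_eq, ← integral_const_mul]
  exact integral_mono_ae (integrable_density u u).re
    ((integrable_density v v).re.const_mul _) h

end X

/-- The product of an element of `X` with a multiplier. -/
noncomputable def IsMultiplier.mulX (hm : IsMultiplier S m M L) (u : X S) : X S :=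
  X.mk (fun x => m x * u.val x) (fun x => m x • u.nabla x + u.val x • grad m x)
    (hm.smooth.continuous.aestronglyMeasurable.mul u.meas_val)
    ((hm.smooth.continuous.aestronglyMeasurable.smul u.meas_nabla).add
      (u.meas_val.smul (continuous_grad (hm.smooth.of_le (by simp))).aestronglyMeasurable))
    (hm.memX u.memX u.meas_val u.meas_nabla)

lemma IsMultiplier.val_mulX (hm : IsMultiplier S m M L) (u : X S) :
    (hm.mulX u).val =ᵐ[volume.restrict Ω] fun x => m x * u.val x := X.val_mk _ _ _ _ _

lemma IsMultiplier.nabla_mulX (hm : IsMultiplier S m M L) (u : X S) :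
    (hm.mulX u).nabla =ᵐ[volume.restrict Ω] fun x => m x • u.nabla x + u.val x • grad m x :=
  X.nabla_mk _ _ _ _ _

/-- Multiplication by a multiplier as a bounded operator on `X`. -/
noncomputable def IsMultiplier.mulOp (hm : IsMultiplier S m M L) : X S →L[ℂ] X S :=
  LinearMap.mkContinuous
    { toFun := hm.mulX
      map_add' := fun u v => by
        refine X.ext_ae ?_ ?_
        · filter_upwards [hm.val_mulX (u + v), hm.val_mulX u, hm.val_mulX v, X.val_add u v,
            X.val_add (hm.mulX u) (hm.mulX v)] with x h1 h2 h3 h4 h5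
          rw [h1, h5, h4, h2, h3]; ring
        · filter_upwards [hm.nabla_mulX (u + v), hm.nabla_mulX u, hm.nabla_mulX v, X.val_add u v,
            X.nabla_add u v, X.nabla_add (hm.mulX u) (hm.mulX v)] with x h1 h2 h3 h4 h5 h6
          rw [h1, h6, h4, h5, h2, h3]; module
      map_smul' := fun c u => by
        refine X.ext_ae ?_ ?_
        · filter_upwards [hm.val_mulX (c • u), hm.val_mulX u, X.val_smul c u,
            X.val_smul c (hm.mulX u)] with x h1 h2 h3 h4
          simp only [RingHom.id_apply]
          rw [h1, h4, h3, h2]; ring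
        · filter_upwards [hm.nabla_mulX (c • u), hm.nabla_mulX u, X.val_smul c u,
            X.nabla_smul c u, X.nabla_smul c (hm.mulX u)] with x h1 h2 h3 h4 h5
          simp only [RingHom.id_apply]
          rw [h1, h5, h4, h3, h2]; module }
    (2 * M + 2 * L) fun u => by
      have M0 : 0 ≤ M := (norm_nonneg _).trans (hm.norm_le 0)
      have L0 : 0 ≤ L := (norm_nonneg _).trans (hm.norm_grad_le 0)
      refine X.norm_le_of_density_le (by positivity) ?_
      filter_upwards [hm.val_mulX u, hm.nabla_mulX u] with x h1 h2
      change RCLike.re (X.density (hm.mulX u) (hm.mulX u) x) ≤ _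
      rw [X.re_density_self, X.re_density_self, h1, h2, norm_mul, mul_pow]
      have h3 := hm.re_inner_W_le x (u.val x) (u.nabla x)
      have h4 : ‖m x‖ ^ 2 ≤ M ^ 2 := pow_le_pow_left₀ (norm_nonneg _) (hm.norm_le x) 2
      have hw : 0 ≤ S.w x := zero_le_one.trans (one_le_w S x)
      have h5 := mul_le_mul_of_nonneg_right h4 (mul_nonneg hw (sq_nonneg ‖u.val x‖))
      have h6 := re_inner_W_nonneg S x (u.nabla x)
      have h7 : 0 ≤ S.w x * ‖u.val x‖ ^ 2 := by positivity
      nlinarith [mul_nonneg (mul_nonneg M0 L0) h6, mul_nonneg (mul_nonneg M0 L0) h7,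
        mul_nonneg (sq_nonneg M) h6, mul_nonneg (sq_nonneg L) h6, mul_nonneg (sq_nonneg M) h7,
        mul_nonneg (sq_nonneg L) h7]

lemma IsMultiplier.val_mulOp (hm : IsMultiplier S m M L) (u : X S) :
    (hm.mulOp u).val =ᵐ[volume.restrict Ω] fun x => m x * u.val x := hm.val_mulX u

lemma IsMultiplier.nabla_mulOp (hm : IsMultiplier S m M L) (u : X S) :
    (hm.mulOp u).nabla =ᵐ[volume.restrict Ω] fun x => m x • u.nabla x + u.val x • grad m x :=
  hm.nabla_mulX u

end Multiplication

/-! ### The weights on annuli beyond the start of the scaling -/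

/-- The closed annulus `{a ≤ |x| ≤ b}`. -/
def annulus (a b : ℝ) : Set E3 := {x | a ≤ ‖x‖ ∧ ‖x‖ ≤ b}

lemma isClosed_annulus (a b : ℝ) : IsClosed (annulus a b) :=
  (isClosed_le continuous_const continuous_norm).inter
    (isClosed_le continuous_norm continuous_const)

lemma isCompact_annulus (a b : ℝ) : IsCompact (annulus a b) :=
  (isCompact_closedBall (0 : E3) b).of_isClosed_subset (isClosed_annulus a b) fun x hx => by
    simpa using hx.2

variable {Ω : Set E3}

lemma Profile.annulus_subset (S : Profile Ω) {a b : ℝ} (ha : S.r₁ < a) : annulus a b ⊆ Ω := by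
  intro x hx
  by_contra h
  have := S.compl_subset h
  rw [mem_ball_zero_iff] at this
  linarith [hx.1]

lemma Profile.continuousOn_α (S : Profile Ω) : ContinuousOn S.α (Ioi S.r₁) := by
  have h1 : ContinuousOn (deriv S.αt) (Ioi S.r₁) :=
    S.αt_C2.continuousOn_deriv_of_isOpen isOpen_Ioi (by norm_num)
  exact (continuousOn_id.mul h1).add S.αt_cont.continuousOn

/-- On an annulus beyond `r₁` the weighted norm is equivalent to the norm of `H¹`. -/
lemma Profile.exists_weight_bound (S : Profile Ω) {a : ℝ} (ha : S.r₁ < a) (b : ℝ) :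
    ∃ κ : ℝ, 1 ≤ κ ∧ ∀ x ∈ annulus a b, S.w x ≤ κ ∧ ∀ g : C3,
      RCLike.re ⟪g, S.W x g⟫_ℂ ≤ κ * ‖g‖ ^ 2 ∧ ‖g‖ ^ 2 ≤ κ * RCLike.re ⟪g, S.W x g⟫_ℂ := by
  have hsub : Icc a b ⊆ Ioi S.r₁ := fun r hr => ha.trans_le hr.1
  have cα : ContinuousOn S.α (Icc a b) := S.continuousOn_α.mono hsub
  have cd : ContinuousOn S.d (Icc a b) :=
    continuousOn_const.add (continuousOn_const.mul (Complex.continuous_ofReal.comp_continuousOn cα))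
  have ct : ContinuousOn S.dt (Icc a b) :=
    (continuous_const.add (continuous_const.mul
      (Complex.continuous_ofReal.comp S.αt_cont))).continuousOn
  obtain ⟨C1, h1⟩ := isCompact_Icc.exists_bound_of_continuousOn cd
  obtain ⟨C2, h2⟩ := isCompact_Icc.exists_bound_of_continuousOn ct
  set k := max 1 (max C1 C2)
  have hk : 1 ≤ k := le_max_left _ _
  have hk2 : k ^ 2 ≤ k ^ 3 := pow_le_pow_right₀ hk (by norm_num)
  have hk1 : k ≤ k ^ 3 := le_self_pow₀ hk (by norm_num)
  refine ⟨k ^ 3, one_le_pow₀ hk, fun x hx => ?_⟩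
  have d1 : 1 ≤ ‖S.d ‖x‖‖ := one_le_norm _
  have t1 : 1 ≤ ‖S.dt ‖x‖‖ := one_le_norm _
  have d2 : ‖S.d ‖x‖‖ ≤ k := (h1 _ hx).trans ((le_max_left _ _).trans (le_max_right _ _))
  have t2 : ‖S.dt ‖x‖‖ ≤ k := (h2 _ hx).trans ((le_max_right _ _).trans (le_max_right _ _))
  have tsq : ‖S.dt ‖x‖‖ ^ 2 ≤ k ^ 2 := pow_le_pow_left₀ (by positivity) t2 2
  constructor
  · rw [Profile.w, norm_mul, norm_pow]
    calc _ ≤ k ^ 2 * k := mul_le_mul tsq d2 (by positivity) (by positivity)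
      _ = k ^ 3 := by ring
  · intro g
    rw [re_inner_W, norm_mul, norm_pow, norm_inv]
    have hpy : ‖g‖ ^ 2 = ‖radProj x g‖ ^ 2 + ‖g - radProj x g‖ ^ 2 := by
      rw [radProj_eq]
      set K := ℂ ∙ toC x
      have hg : g = K.starProjection g + (g - K.starProjection g) := by abel
      have ho : ⟪K.starProjection g, g - K.starProjection g⟫_ℂ = 0 :=
        Submodule.inner_right_of_mem_orthogonal (Submodule.starProjection_apply_mem _ _)
          (Submodule.sub_starProjection_mem_orthogonal g)
      conv_lhs => rw [hg]
      have := norm_add_sq_eq_norm_sq_add_norm_sq_of_inner_eq_zero _ _ ho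
      simp only [sq]
      exact this
    set p := ‖radProj x g‖ ^ 2
    set q := ‖g - radProj x g‖ ^ 2
    have p0 : 0 ≤ p := sq_nonneg _
    have q0 : 0 ≤ q := sq_nonneg _
    rw [hpy]
    set A := ‖S.dt ‖x‖‖ ^ 2 * ‖S.d ‖x‖‖⁻¹
    have A1 : A ≤ k ^ 3 := by
      refine le_trans ?_ hk2
      calc A ≤ k ^ 2 * 1 := mul_le_mul tsq (inv_le_one_of_one_le₀ d1) (by positivity)
            (by positivity)
        _ = k ^ 2 := mul_one _
    have A2 : 1 ≤ k ^ 3 * A := by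
      have : k⁻¹ ≤ A := by
        calc k⁻¹ ≤ ‖S.d ‖x‖‖⁻¹ := inv_anti₀ (by linarith) d2
          _ ≤ A := le_mul_of_one_le_left (by positivity) (one_le_pow₀ t1)
      calc (1 : ℝ) = k * k⁻¹ := (mul_inv_cancel₀ (by linarith)).symm
        _ ≤ k ^ 3 * A := mul_le_mul hk1 this (by positivity) (by positivity)
    have d3 : 1 ≤ k ^ 3 * ‖S.d ‖x‖‖ := one_le_mul_of_one_le_of_one_le (one_le_pow₀ hk) d1
    constructor
    · nlinarith [mul_le_mul_of_nonneg_right A1 p0, mul_le_mul_of_nonneg_right (d2.trans hk1) q0]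
    · nlinarith [mul_le_mul_of_nonneg_right A2 p0, mul_le_mul_of_nonneg_right d3 q0]

/-! ### Radial multipliers -/

/-- A radial function whose profile is smooth on `[r₁, ∞)` and constant on `[0, a]` for some
`a > r₁` is smooth. -/
lemma contDiff_comp_norm {η : ℝ → ℂ} {r₁ a : ℝ} {c : ℂ} (hr : 0 < r₁) (ha : r₁ < a)
    (hs : ContDiffOn ℝ (⊤ : ℕ∞) η (Ici r₁)) (hc : ∀ r, 0 ≤ r → r ≤ a → η r = c) :
    ContDiff ℝ (⊤ : ℕ∞) fun x : E3 => η ‖x‖ := by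
  rw [contDiff_iff_contDiffAt]
  intro x
  rcases lt_or_ge ‖x‖ a with h | h
  · refine (contDiffAt_const (c := c)).congr_of_eventuallyEq ?_
    filter_upwards [continuous_norm.continuousAt.eventually (gt_mem_nhds h)] with y hy
    exact hc _ (norm_nonneg _) hy.le
  · have h1 : ContDiffAt ℝ (⊤ : ℕ∞) η ‖x‖ :=
      hs.contDiffAt (Ici_mem_nhds (ha.trans_le h))
    have hx : x ≠ 0 := by rw [← norm_pos_iff]; linarith
    exact h1.comp x (contDiffAt_norm ℝ hx)

lemma grad_eq_zero_of_eventually_eq {m : E3 → ℂ} {x : E3} {c : ℂ} (h : m =ᶠ[𝓝 x] fun _ => c) :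
    grad m x = 0 := by
  ext i
  simp [grad, h.fderiv_eq]

lemma grad_eq_zero_of_notMem_annulus {m : E3 → ℂ} {a b : ℝ} {c l : ℂ}
    (h1 : ∀ x, ‖x‖ ≤ a → m x = c) (h2 : ∀ x, b ≤ ‖x‖ → m x = l) {x : E3}
    (hx : x ∉ annulus a b) : grad m x = 0 := by
  have hx' : ‖x‖ < a ∨ b < ‖x‖ := by
    by_contra h; push Not at h; exact hx h
  rcases hx' with h | h
  · refine grad_eq_zero_of_eventually_eq (c := c) ?_
    filter_upwards [continuous_norm.continuousAt.eventually (gt_mem_nhds h)] with y hy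
    exact h1 y hy.le
  · refine grad_eq_zero_of_eventually_eq (c := l) ?_
    filter_upwards [continuous_norm.continuousAt.eventually (lt_mem_nhds h)] with y hy
    exact h2 y hy.le

lemma exists_bound_of_eq_zero_off_compact {F : Type*} [NormedAddCommGroup F] {f : E3 → F}
    {K : Set E3} (hK : IsCompact K) (hf : Continuous f) (h0 : ∀ x, x ∉ K → f x = 0) :
    ∃ C : ℝ, 0 ≤ C ∧ ∀ x, ‖f x‖ ≤ C := by
  obtain ⟨C, hC⟩ := hK.exists_bound_of_continuousOn hf.continuousOn
  refine ⟨max C 0, le_max_right _ _, fun x => ?_⟩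
  by_cases hx : x ∈ K
  · exact (hC x hx).trans (le_max_left _ _)
  · simp [h0 x hx]

/-- A smooth function that is constant inside a ball of radius greater than `r₁` and constant
outside some ball is a multiplier, with bounded second derivatives. -/
lemma exists_isMultiplier (S : Profile Ω) {m : E3 → ℂ} {a b : ℝ} {c l : ℂ}
    (hm : ContDiff ℝ (⊤ : ℕ∞) m) (ha : S.r₁ < a)
    (h1 : ∀ x, ‖x‖ ≤ a → m x = c) (h2 : ∀ x, b ≤ ‖x‖ → m x = l) :
    ∃ M L N : ℝ, IsMultiplier S m M L ∧ ∀ x i, ‖grad (fun y => grad m y i) x‖ ≤ N := by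
  have hcg := continuous_grad (hm.of_le (by simp))
  have hcomp : ∀ i, ContDiff ℝ 1 fun y => grad m y i := fun i =>
    (hm.fderiv_right (m := 1) (by norm_cast)).clm_apply contDiff_const
  have z1 : ∀ x, x ∉ annulus a b → grad m x = 0 := fun x hx =>
    grad_eq_zero_of_notMem_annulus h1 h2 hx
  obtain ⟨M0, -, hM0⟩ := exists_bound_of_eq_zero_off_compact (f := fun x => m x - l)
    (isCompact_closedBall (0 : E3) b) (hm.continuous.sub continuous_const) fun x hx => by
      rw [mem_closedBall_zero_iff, not_le] at hx
      simp [h2 x hx.le]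
  obtain ⟨L0, L0', hL0⟩ := exists_bound_of_eq_zero_off_compact (isCompact_annulus a b) hcg z1
  have hN : ∀ i : Fin 3, ∃ N : ℝ, 0 ≤ N ∧ ∀ x, ‖grad (fun y => grad m y i) x‖ ≤ N := by
    intro i
    refine exists_bound_of_eq_zero_off_compact (isCompact_annulus a b)
      (continuous_grad (hcomp i)) fun x hx => ?_
    refine grad_eq_zero_of_eventually_eq (c := 0) ?_
    filter_upwards [(isClosed_annulus a b).isOpen_compl.mem_nhds hx] with y hy
    rw [z1 y hy]; rfl
  choose N N0 hN using hN
  obtain ⟨κ, hκ1, hκ⟩ := S.exists_weight_bound ha b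
  have hκs : κ ≤ κ ^ 2 := le_self_pow₀ hκ1 (by norm_num)
  refine ⟨M0 + ‖l‖, κ * L0, ∑ i, N i, ⟨hm, fun x => ?_, fun x => ?_, fun x => ?_⟩, fun x i => ?_⟩
  · calc ‖m x‖ = ‖(m x - l) + l‖ := by rw [sub_add_cancel]
      _ ≤ _ := (norm_add_le _ _).trans (by gcongr; exact hM0 x)
  · exact (hL0 x).trans (le_mul_of_one_le_left L0' hκ1)
  · by_cases hx : x ∈ annulus a b
    · refine ((hκ x hx).2 _).1.trans ?_
      have h3 : ‖grad m x‖ ^ 2 ≤ L0 ^ 2 := pow_le_pow_left₀ (norm_nonneg _) (hL0 x) 2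
      rw [mul_pow]
      exact mul_le_mul hκs h3 (by positivity) (by positivity)
    · rw [z1 x hx]; simp; positivity
  · exact (hN i x).trans (Finset.single_le_sum (f := N) (fun j _ => N0 j) (Finset.mem_univ i))

/-- A bound for the gradient is a Lipschitz constant. -/
lemma norm_sub_le_of_norm_grad_le {m : E3 → ℂ} {L : ℝ} (hm : Differentiable ℝ m)
    (h : ∀ x, ‖grad m x‖ ≤ L) (x y : E3) : ‖m x - m y‖ ≤ L * ‖x - y‖ :=
  convex_univ.norm_image_sub_le_of_norm_fderiv_le (fun z _ => hm z)
    (fun z _ => (norm_fderiv_le_norm_grad m z).trans (h z)) (mem_univ y) (mem_univ x)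

/-! ### Local energies -/

variable {S : Profile Ω}

namespace X

/-- The density `|u|² + |∇u|²` of the squared norm of `H¹`. -/
noncomputable def dens (u : X S) (x : E3) : ℝ≥0∞ := ‖u.val x‖ₑ ^ 2 + ‖u.nabla x‖ₑ ^ 2

/-- The squared norm of `H¹(D)`, with values in `[0, ∞]`. -/
noncomputable def energy (u : X S) (D : Set E3) : ℝ≥0∞ := ∫⁻ x in D, dens u x

lemma measurable_enorm_val_sq (u : X S) : Measurable fun x => ‖u.val x‖ₑ ^ 2 :=
  ((Subtype.val u).1.stronglyMeasurable.enorm).pow_const 2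

lemma measurable_enorm_nabla_sq (u : X S) : Measurable fun x => ‖u.nabla x‖ₑ ^ 2 :=
  ((Subtype.val u).2.stronglyMeasurable.enorm).pow_const 2

lemma measurable_dens (u : X S) : Measurable (dens u) :=
  u.measurable_enorm_val_sq.add u.measurable_enorm_nabla_sq

lemma energy_eq_add (u : X S) (D : Set E3) : energy u D
    = (∫⁻ x in D, ‖u.val x‖ₑ ^ 2) + ∫⁻ x in D, ‖u.nabla x‖ₑ ^ 2 :=
  lintegral_add_left u.measurable_enorm_val_sq _

lemma ae_restrict_of_subset {D : Set E3} (hD : D ⊆ Ω) {p : E3 → Prop}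
    (h : ∀ᵐ x ∂volume.restrict Ω, p x) : ∀ᵐ x ∂volume.restrict D, p x :=
  ae_mono (Measure.restrict_mono hD le_rfl) h

lemma energy_add_le (u v : X S) {D : Set E3} (hD : D ⊆ Ω) :
    energy (u + v) D ≤ 2 * energy u D + 2 * energy v D := by
  simp only [energy]
  rw [← lintegral_const_mul _ u.measurable_dens, ← lintegral_const_mul _ v.measurable_dens,
    ← lintegral_add_left (u.measurable_dens.const_mul 2)]
  refine lintegral_mono_ae ?_
  filter_upwards [ae_restrict_of_subset hD (val_add u v),
    ae_restrict_of_subset hD (nabla_add u v)] with x h1 h2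
  simp only [dens, h1, h2]
  refine (add_le_add (enorm_add_sq_le _ _) (enorm_add_sq_le _ _)).trans_eq (by ring)

lemma energy_smul (c : ℂ) (u : X S) {D : Set E3} (hD : D ⊆ Ω) :
    energy (c • u) D = ‖c‖ₑ ^ 2 * energy u D := by
  simp only [energy]
  rw [← lintegral_const_mul _ u.measurable_dens]
  refine lintegral_congr_ae ?_
  filter_upwards [ae_restrict_of_subset hD (val_smul c u),
    ae_restrict_of_subset hD (nabla_smul c u)] with x h1 h2
  simp only [dens, h1, h2, enorm_mul, enorm_smul]
  ring

lemma memLp_of_subset (u : X S) {D : Set E3} (hD : D ⊆ Ω) (hb : Bornology.IsBounded D) :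
    MemLp u.val 2 (volume.restrict D) ∧ MemLp u.nabla 2 (volume.restrict D) := by
  obtain ⟨R, hR0, hR⟩ := hb.subset_ball_lt 0 0
  have hle : volume.restrict D ≤ volume.restrict (Ω ∩ Metric.ball (0 : E3) R) :=
    Measure.restrict_mono (subset_inter hD hR) le_rfl
  exact ⟨(u.memX.memLp R hR0).mono_measure hle, (u.memX.memLp_grad R hR0).mono_measure hle⟩

lemma ofReal_normH1_sq (u : X S) {D : Set E3} (hD : D ⊆ Ω) (hb : Bornology.IsBounded D) :
    ENNReal.ofReal (normH1 D u.val u.nabla ^ 2) = energy u D := by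
  obtain ⟨h1, h2⟩ := u.memLp_of_subset hD hb
  have i1 : Integrable (fun x => ‖u.val x‖ ^ 2) (volume.restrict D) :=
    (memLp_two_iff_integrable_sq_norm h1.1).1 h1
  have i2 : Integrable (fun x => ‖u.nabla x‖ ^ 2) (volume.restrict D) :=
    (memLp_two_iff_integrable_sq_norm h2.1).1 h2
  rw [normH1, Real.sq_sqrt (integral_nonneg fun x => by positivity),
    ofReal_integral_eq_lintegral_ofReal (f := fun x => ‖u.val x‖ ^ 2 + ‖u.nabla x‖ ^ 2)
      (i1.add i2) (ae_of_all _ fun x => by positivity)]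
  refine lintegral_congr fun x => ?_
  rw [ENNReal.ofReal_add (by positivity) (by positivity), ENNReal.ofReal_pow (norm_nonneg _),
    ENNReal.ofReal_pow (norm_nonneg _), ofReal_norm, ofReal_norm, dens]

end X

/-- Without integrability the left hand side is zero. -/
lemma ofReal_integral_le_lintegral {α : Type*} [MeasurableSpace α] {μ : Measure α} {f : α → ℝ}
    (hf : ∀ x, 0 ≤ f x) : ENNReal.ofReal (∫ x, f x ∂μ) ≤ ∫⁻ x, ENNReal.ofReal (f x) ∂μ := by
  by_cases h : Integrable f μ
  · exact (ofReal_integral_eq_lintegral_ofReal h (ae_of_all _ hf)).le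
  · simp [integral_undef h]

/-- A pointwise bound controls the norm of `H²`. -/
lemma ofReal_normH2_sq_le {D : Set E3} {u : E3 → ℂ} {g : E3 → C3} {G : Fin 3 → E3 → C3} {c : ℝ}
    (h : ∀ᵐ x ∂volume.restrict D, ‖u x‖ ^ 2 + ‖g x‖ ^ 2 + ∑ i, ‖G i x‖ ^ 2 ≤ c) :
    ENNReal.ofReal (normH2 D u g G ^ 2) ≤ ENNReal.ofReal c * volume D := by
  rw [normH2, Real.sq_sqrt (integral_nonneg fun x => by positivity)]
  refine (ofReal_integral_le_lintegral fun x => by positivity).trans ?_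
  rw [← setLIntegral_const]
  exact lintegral_mono_ae (h.mono fun x hx => ENNReal.ofReal_le_ofReal hx)

/-- The weak gradient of an element of `X` vanishes where the element is constant. -/
lemma X.nabla_ae_eq_zero (u : X S) {B : Set E3} (hBo : IsOpen B) (hB : B ⊆ Ω)
    (hb : Bornology.IsBounded B) {c : ℂ} (hu : ∀ᵐ x ∂volume.restrict B, u.val x = c) :
    ∀ᵐ x ∂volume.restrict B, u.nabla x = 0 := by
  have h1 : IsWeakGradient B (fun x => u.val x - c) u.nabla := by
    intro φ hφ hφc hφs i
    have w1 := u.memX.weakGradient.mono hB φ hφ hφc hφs i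
    have w2 := isWeakGradient_grad (D := B) (f := fun _ => c) contDiff_const φ hφ hφc hφs i
    have t3 : ∫ x in B, ((fderiv ℝ φ x (e i) : ℝ) : ℂ) * u.val x = 0 := by
      rw [integral_congr_ae (g := fun x => ((fderiv ℝ φ x (e i) : ℝ) : ℂ) * c)
        (hu.mono fun x hx => by simp only [hx]), w2]
      simp [grad]
    have t4 : ∫ x in B, ((fderiv ℝ φ x (e i) : ℝ) : ℂ) * (u.val x - c) = 0 := by
      rw [← integral_zero E3 ℂ (μ := volume.restrict B)]
      exact integral_congr_ae (hu.mono fun x hx => by simp only [hx]; ring)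
    rw [t4, ← w1, t3]
  exact h1.ae_eq_zero hBo subset_rfl
    (fun r hr => (u.memLp_of_subset (inter_subset_left.trans hB) (hb.subset inter_subset_left)).2)
    (hu.mono fun x hx => by simp [hx])

/-- The Poincaré inequality in `X`, on balls inside `Ω`. -/
lemma X.poincare (u : X S) {x₀ : E3} {ρ : ℝ} (hρ : 0 < ρ) (hB : Metric.ball x₀ ρ ⊆ Ω) :
    ∫⁻ x in Metric.ball x₀ ρ, ‖u.val x - ⨍ y in Metric.ball x₀ ρ, u.val y‖ₑ ^ 2
      ≤ 64 * ENNReal.ofReal ρ ^ 2 * ∫⁻ x in Metric.ball x₀ ρ, ‖u.nabla x‖ₑ ^ 2 := by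
  obtain ⟨h1, h2⟩ := u.memLp_of_subset hB Metric.isBounded_ball
  refine poincare_of_approx hρ h1 h2.1 fun δ hδ => ?_
  obtain ⟨R, hR0, hR⟩ := (Metric.isBounded_ball (x := x₀) (r := ρ)).subset_ball_lt 0 0
  obtain ⟨φ, hφ, -, a, b, -⟩ := u.memX.trace R hR0 δ hδ
  have hle : volume.restrict (Metric.ball x₀ ρ) ≤ volume.restrict (Ω ∩ Metric.ball (0 : E3) R) :=
    Measure.restrict_mono (subset_inter hB hR) le_rfl
  exact ⟨φ, hφ.of_le (by simp), (eLpNorm_mono_measure _ hle).trans_lt a,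
    (eLpNorm_mono_measure _ hle).trans_lt b⟩

/-! ### The local commutator estimate -/

lemma ofReal_sq_norm {F : Type*} [NormedAddCommGroup F] (z : F) :
    ENNReal.ofReal (‖z‖ ^ 2) = ‖z‖ₑ ^ 2 := by
  rw [ENNReal.ofReal_pow (norm_nonneg _), ofReal_norm]

/-- Freezing the multiplier at the centre `x₀` of a ball of radius `ρ` on which the multiplied
function `v` has a small `L²` norm gains a factor `ρ`. -/
lemma IsMultiplier.energy_sub_le {m : E3 → ℂ} {M L : ℝ} (hm : IsMultiplier S m M L) {x₀ : E3}
    {ρ : ℝ} (hρ : 0 < ρ) (hρ1 : ρ ≤ 1) (hB : Metric.ball x₀ ρ ⊆ Ω) (v : X S)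
    (hv : ∫⁻ x in Metric.ball x₀ ρ, ‖v.val x‖ₑ ^ 2
      ≤ 64 * ENNReal.ofReal ρ ^ 2 * ∫⁻ x in Metric.ball x₀ ρ, ‖v.nabla x‖ₑ ^ 2) :
    (hm.mulOp v - m x₀ • v).energy (Metric.ball x₀ ρ)
      ≤ ENNReal.ofReal (194 * L ^ 2 * ρ ^ 2) * ∫⁻ x in Metric.ball x₀ ρ, ‖v.nabla x‖ₑ ^ 2 := by
  have L0 : 0 ≤ L := (norm_nonneg _).trans (hm.norm_grad_le 0)
  set B := Metric.ball x₀ ρ with hBdef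
  have hae : ∀ᵐ x ∂volume.restrict B, (hm.mulOp v - m x₀ • v).dens x
      ≤ ENNReal.ofReal (3 * L ^ 2) * ‖v.val x‖ₑ ^ 2
        + ENNReal.ofReal (2 * L ^ 2 * ρ ^ 2) * ‖v.nabla x‖ₑ ^ 2 := by
    have e0 : hm.mulOp v - m x₀ • v = hm.mulOp v + (-m x₀) • v := by rw [neg_smul, sub_eq_add_neg]
    rw [e0]
    filter_upwards [X.ae_restrict_of_subset hB (X.val_add (hm.mulOp v) ((-m x₀) • v)),
      X.ae_restrict_of_subset hB (X.nabla_add (hm.mulOp v) ((-m x₀) • v)),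
      X.ae_restrict_of_subset hB (X.val_smul (-m x₀) v),
      X.ae_restrict_of_subset hB (X.nabla_smul (-m x₀) v),
      X.ae_restrict_of_subset hB (hm.val_mulOp v),
      X.ae_restrict_of_subset hB (hm.nabla_mulOp v),
      ae_restrict_mem (μ := volume) (s := B) measurableSet_ball] with x h1 h2 h3 h4 h5 h6 hx
    have hlip : ‖m x - m x₀‖ ≤ L * ρ :=
      (norm_sub_le_of_norm_grad_le (hm.smooth.differentiable (by simp)) hm.norm_grad_le x x₀).trans
        (mul_le_mul_of_nonneg_left (by
          rw [← dist_eq_norm]; exact (Metric.mem_ball.1 hx).le) L0)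
    have e1 : m x * v.val x + -m x₀ * v.val x = (m x - m x₀) * v.val x := by ring
    have e2 : m x • v.nabla x + v.val x • grad m x + -m x₀ • v.nabla x
        = (m x - m x₀) • v.nabla x + v.val x • grad m x := by module
    rw [X.dens, h1, h2, h3, h4, h5, h6, e1, e2, ← ofReal_sq_norm, ← ofReal_sq_norm,
      ← ofReal_sq_norm, ← ofReal_sq_norm, ← ENNReal.ofReal_mul (by positivity),
      ← ENNReal.ofReal_mul (by positivity), ← ENNReal.ofReal_add (by positivity) (by positivity),
      ← ENNReal.ofReal_add (by positivity) (by positivity)]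
    refine ENNReal.ofReal_le_ofReal ?_
    have s1 : ‖(m x - m x₀) * v.val x‖ ^ 2 ≤ L ^ 2 * ‖v.val x‖ ^ 2 := by
      rw [norm_mul, mul_pow]
      refine mul_le_mul_of_nonneg_right (pow_le_pow_left₀ (norm_nonneg _) (hlip.trans ?_) 2)
        (sq_nonneg _)
      exact mul_le_of_le_one_right L0 hρ1
    have s2 : ‖(m x - m x₀) • v.nabla x‖ ^ 2 ≤ L ^ 2 * ρ ^ 2 * ‖v.nabla x‖ ^ 2 := by
      rw [norm_smul, mul_pow, ← mul_pow L]
      exact mul_le_mul_of_nonneg_right (pow_le_pow_left₀ (norm_nonneg _) hlip 2) (sq_nonneg _)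
    have s3 : ‖v.val x • grad m x‖ ^ 2 ≤ L ^ 2 * ‖v.val x‖ ^ 2 := by
      rw [norm_smul, mul_pow, mul_comm]
      exact mul_le_mul_of_nonneg_right
        (pow_le_pow_left₀ (norm_nonneg _) (hm.norm_grad_le x) 2) (sq_nonneg _)
    have s4 := norm_add_le ((m x - m x₀) • v.nabla x) (v.val x • grad m x)
    have s5 := norm_nonneg ((m x - m x₀) • v.nabla x + v.val x • grad m x)
    nlinarith [sq_nonneg (‖(m x - m x₀) • v.nabla x‖ - ‖v.val x • grad m x‖)]
  calc _ ≤ ∫⁻ x in B, (ENNReal.ofReal (3 * L ^ 2) * ‖v.val x‖ₑ ^ 2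
        + ENNReal.ofReal (2 * L ^ 2 * ρ ^ 2) * ‖v.nabla x‖ₑ ^ 2) := lintegral_mono_ae hae
    _ = ENNReal.ofReal (3 * L ^ 2) * (∫⁻ x in B, ‖v.val x‖ₑ ^ 2)
        + ENNReal.ofReal (2 * L ^ 2 * ρ ^ 2) * ∫⁻ x in B, ‖v.nabla x‖ₑ ^ 2 := by
      rw [lintegral_add_left (v.measurable_enorm_val_sq.const_mul _),
        lintegral_const_mul _ v.measurable_enorm_val_sq,
        lintegral_const_mul _ v.measurable_enorm_nabla_sq]
    _ ≤ ENNReal.ofReal (3 * L ^ 2) * (64 * ENNReal.ofReal ρ ^ 2 * ∫⁻ x in B, ‖v.nabla x‖ₑ ^ 2)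
        + ENNReal.ofReal (2 * L ^ 2 * ρ ^ 2) * ∫⁻ x in B, ‖v.nabla x‖ₑ ^ 2 := by gcongr
    _ = _ := by
      have e64 : (64 : ℝ≥0∞) * ENNReal.ofReal ρ ^ 2 = ENNReal.ofReal (64 * ρ ^ 2) := by
        rw [ENNReal.ofReal_mul (by norm_num), ENNReal.ofReal_pow hρ.le]; norm_num
      rw [e64, ← mul_assoc, ← ENNReal.ofReal_mul (by positivity), ← add_mul,
        ← ENNReal.ofReal_add (by positivity) (by positivity)]
      congr 2
      -- `194 = 3 * 64 + 2`, with the Poincaré constant `64`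
      ring

/-- The discrete commutator property on one ball: for a projection with local approximation
properties of first and second order, `u ↦ (1 - P)(m u)` gains a factor `h` on elements `u` of the
range of `P`. Up to elements of the range, `m u` is the sum of `(m - m(x₀)) (u - c)`, which is
small in `H¹` if `c` is the mean value of `u`, and of `c (m - m(x₀))`, which is smooth. -/
lemma IsMultiplier.energy_commutator_le {m : E3 → ℂ} {M L N : ℝ} (hm : IsMultiplier S m M L)
    (hN : ∀ x i, ‖grad (fun y => grad m y i) x‖ ≤ N)
    {V : Submodule ℂ (X S)} {P : X S →L[ℂ] V} (hP : ∀ v : V, P v = v) {χ : X S}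
    {x₀ : E3} {h R C : ℝ} (hh : 0 < h) (hR : 1 < R) (hRh : R * h ≤ 1)
    (hB : Metric.ball x₀ (R * h) ⊆ Ω)
    (hχ : ∀ᵐ x ∂volume.restrict (Metric.ball x₀ (R * h)), χ.val x = 1)
    (happ : ∀ u : X S,
      normH1 (Metric.ball x₀ h) (u - P u).val (u - P u).nabla
          ≤ C * normH1 (Metric.ball x₀ (R * h)) u.val u.nabla ∧
      ∀ G, IsWeakHessian (Metric.ball x₀ (R * h)) u.nabla G →
        normH1 (Metric.ball x₀ h) (u - P u).val (u - P u).nabla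
          ≤ C * h * normH2 (Metric.ball x₀ (R * h)) u.val u.nabla G)
    {u : X S} (huV : u ∈ V) :
    (hm.mulOp u - P (hm.mulOp u)).energy (Metric.ball x₀ h)
      ≤ ENNReal.ofReal (C ^ 2 * (388 * L ^ 2 * R ^ 2 + 4 * L ^ 2 + 6 * N ^ 2) * h ^ 2)
        * u.energy (Metric.ball x₀ (R * h)) := by
  have L0 : 0 ≤ L := (norm_nonneg _).trans (hm.norm_grad_le 0)
  set ρ := R * h with hρdef
  have hρ : 0 < ρ := by positivity
  set B := Metric.ball x₀ ρ with hBdef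
  have hhB : Metric.ball x₀ h ⊆ Ω :=
    (Metric.ball_subset_ball (by rw [hρdef]; nlinarith)).trans hB
  have bB : Bornology.IsBounded B := Metric.isBounded_ball
  have hfix : ∀ v ∈ V, ((P v : V) : X S) = v := fun v hv => congrArg _ (hP ⟨v, hv⟩)
  set c := ⨍ y in B, u.val y with hc
  set v : X S := u - c • χ with hv
  set a : X S := hm.mulOp v - m x₀ • v with ha
  set b : X S := hm.mulOp χ - m x₀ • χ with hb
  have hχg : ∀ᵐ x ∂volume.restrict B, χ.nabla x = 0 :=
    χ.nabla_ae_eq_zero Metric.isOpen_ball hB bB hχ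
  -- `m u = a + c b + m(x₀) u`, and `1 - P` annihilates `u`. The element `χ` serves as the
  -- constant function `1`, which does not belong to `X`; it need not belong to `V` either.
  have hsplit : hm.mulOp u - P (hm.mulOp u) = (a - P a) + c • (b - P b) := by
    have e1 : hm.mulOp u = a + c • b + m x₀ • u := by
      simp only [ha, hb, hv, map_sub, map_smul]; module
    rw [e1]
    simp only [map_add, map_smul, Submodule.coe_add, Submodule.coe_smul, hfix u huV]
    module
  -- `v = u - c` on the ball, where `c` is the mean value of `u`, so that Poincaré applies.
  have hva : ∀ᵐ x ∂volume.restrict B, v.val x = u.val x - c ∧ v.nabla x = u.nabla x := by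
    have e0 : v = u + (-c) • χ := by rw [hv, neg_smul, sub_eq_add_neg]
    rw [e0]
    filter_upwards [X.ae_restrict_of_subset hB (X.val_add u ((-c) • χ)),
      X.ae_restrict_of_subset hB (X.nabla_add u ((-c) • χ)),
      X.ae_restrict_of_subset hB (X.val_smul (-c) χ),
      X.ae_restrict_of_subset hB (X.nabla_smul (-c) χ), hχ, hχg] with x h1 h2 h3 h4 h5 h6
    rw [h1, h2, h3, h4, h5, h6]
    constructor
    · ring
    · simp
  have hv1 : ∫⁻ x in B, ‖v.val x‖ₑ ^ 2 = ∫⁻ x in B, ‖u.val x - c‖ₑ ^ 2 :=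
    lintegral_congr_ae (hva.mono fun x hx => by simp only [hx.1])
  have hv2 : ∫⁻ x in B, ‖v.nabla x‖ₑ ^ 2 = ∫⁻ x in B, ‖u.nabla x‖ₑ ^ 2 :=
    lintegral_congr_ae (hva.mono fun x hx => by simp only [hx.2])
  have hue : ∫⁻ x in B, ‖u.nabla x‖ₑ ^ 2 ≤ u.energy B := by
    rw [X.energy_eq_add]; exact le_add_self
  have hue2 : ∫⁻ x in B, ‖u.val x‖ₑ ^ 2 ≤ u.energy B := by
    rw [X.energy_eq_add]; exact le_self_add
  have part1 : (a - P a).energy (Metric.ball x₀ h)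
      ≤ ENNReal.ofReal (C ^ 2) * (ENNReal.ofReal (194 * L ^ 2 * ρ ^ 2) * u.energy B) := by
    have k1 := hm.energy_sub_le hρ hRh hB v (by rw [hv1, hv2]; exact u.poincare hρ hB)
    rw [hv2] at k1
    rw [← X.ofReal_normH1_sq _ hhB Metric.isBounded_ball]
    calc _ ≤ ENNReal.ofReal ((C * normH1 B a.val a.nabla) ^ 2) :=
          ENNReal.ofReal_le_ofReal (pow_le_pow_left₀ (Real.sqrt_nonneg _) (happ a).1 2)
      _ = ENNReal.ofReal (C ^ 2) * a.energy B := by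
          rw [mul_pow, ENNReal.ofReal_mul (by positivity), X.ofReal_normH1_sq _ hB bB]
      _ ≤ _ := by
          gcongr
          exact k1.trans (by gcongr)
  -- `b = m - m(x₀)` on the ball is smooth, so that approximation of second order applies.
  have hba : ∀ᵐ x ∂volume.restrict B, b.val x = m x - m x₀ ∧ b.nabla x = grad m x := by
    have e0 : b = hm.mulOp χ + (-m x₀) • χ := by rw [hb, neg_smul, sub_eq_add_neg]
    rw [e0]
    filter_upwards [X.ae_restrict_of_subset hB (X.val_add (hm.mulOp χ) ((-m x₀) • χ)),
      X.ae_restrict_of_subset hB (X.nabla_add (hm.mulOp χ) ((-m x₀) • χ)),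
      X.ae_restrict_of_subset hB (X.val_smul (-m x₀) χ),
      X.ae_restrict_of_subset hB (X.nabla_smul (-m x₀) χ),
      X.ae_restrict_of_subset hB (hm.val_mulOp χ),
      X.ae_restrict_of_subset hB (hm.nabla_mulOp χ), hχ, hχg] with x h1 h2 h3 h4 h5 h6 h7 h8
    rw [h1, h2, h3, h4, h5, h6, h7, h8]
    constructor
    · ring
    · simp
  have hcomp : ∀ i, ContDiff ℝ 1 fun y => grad m y i := fun i =>
    (hm.smooth.fderiv_right (m := 1) (by norm_cast)).clm_apply contDiff_const
  have hHess : IsWeakHessian B b.nabla fun i => grad fun y => grad m y i := by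
    intro i
    constructor
    · intro φ hφ hφc hφs j
      have := isWeakGradient_grad (D := B) (hcomp i) φ hφ hφc hφs j
      rw [← this]
      exact integral_congr_ae (hba.mono fun x hx => by simp only [hx.2])
    · have : IsFiniteMeasure (volume.restrict B) := ⟨by simpa using measure_ball_lt_top⟩
      exact MemLp.of_bound (continuous_grad (hcomp i)).aestronglyMeasurable N
        (ae_of_all _ fun x => hN x i)
  have part2 : (b - P b).energy (Metric.ball x₀ h)
      ≤ ENNReal.ofReal (C ^ 2 * h ^ 2 * (2 * L ^ 2 + 3 * N ^ 2)) * volume B := by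
    rw [← X.ofReal_normH1_sq _ hhB Metric.isBounded_ball]
    calc _ ≤ ENNReal.ofReal ((C * h * normH2 B b.val b.nabla
            fun i => grad fun y => grad m y i) ^ 2) :=
          ENNReal.ofReal_le_ofReal (pow_le_pow_left₀ (Real.sqrt_nonneg _) ((happ b).2 _ hHess) 2)
      _ = ENNReal.ofReal (C ^ 2 * h ^ 2) * ENNReal.ofReal (normH2 B b.val b.nabla
            (fun i => grad fun y => grad m y i) ^ 2) := by
          rw [mul_pow, mul_pow, ENNReal.ofReal_mul (by positivity)]
      _ ≤ ENNReal.ofReal (C ^ 2 * h ^ 2) * (ENNReal.ofReal (2 * L ^ 2 + 3 * N ^ 2) * volume B) := by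
          gcongr
          refine ofReal_normH2_sq_le ?_
          filter_upwards [hba, ae_restrict_mem (μ := volume) (s := B) measurableSet_ball]
            with x hx hxB
          rw [hx.1, hx.2]
          have q1 : ‖m x - m x₀‖ ≤ L := by
            refine (norm_sub_le_of_norm_grad_le (hm.smooth.differentiable (by simp))
              hm.norm_grad_le x x₀).trans ?_
            rw [← dist_eq_norm]
            exact mul_le_of_le_one_right L0 ((Metric.mem_ball.1 hxB).le.trans hRh)
          have q2 : ‖m x - m x₀‖ ^ 2 ≤ L ^ 2 := pow_le_pow_left₀ (norm_nonneg _) q1 2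
          have q3 : ‖grad m x‖ ^ 2 ≤ L ^ 2 :=
            pow_le_pow_left₀ (norm_nonneg _) (hm.norm_grad_le x) 2
          have q4 : ∑ i : Fin 3, ‖grad (fun y => grad m y i) x‖ ^ 2 ≤ ∑ _i : Fin 3, N ^ 2 :=
            Finset.sum_le_sum fun i _ => pow_le_pow_left₀ (norm_nonneg _) (hN x i) 2
          simp only [Finset.sum_const, Finset.card_univ, Fintype.card_fin, nsmul_eq_mul] at q4
          push_cast at q4
          linarith
      _ = _ := by rw [← mul_assoc, ← ENNReal.ofReal_mul (by positivity)]
  have hcB : ‖c‖ₑ ^ 2 * volume B ≤ u.energy B := by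
    have hνt : volume B ≠ ⊤ := measure_ball_lt_top.ne
    have hν0 : volume B ≠ 0 := (Metric.measure_ball_pos _ x₀ hρ).ne'
    have := enorm_average_sq_mul_le (μ := volume.restrict B) (f := u.val)
      (by rwa [Measure.restrict_apply_univ]) (by rwa [Measure.restrict_apply_univ])
      (u.memLp_of_subset hB bB).1.1
    rw [Measure.restrict_apply_univ] at this
    exact this.trans hue2
  rw [hsplit]
  calc _ ≤ 2 * (a - P a).energy (Metric.ball x₀ h)
        + 2 * (‖c‖ₑ ^ 2 * (b - P b).energy (Metric.ball x₀ h)) := by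
        rw [← X.energy_smul c _ hhB]; exact X.energy_add_le _ _ hhB
    _ ≤ 2 * (ENNReal.ofReal (C ^ 2) * (ENNReal.ofReal (194 * L ^ 2 * ρ ^ 2) * u.energy B))
        + 2 * (‖c‖ₑ ^ 2 * (ENNReal.ofReal (C ^ 2 * h ^ 2 * (2 * L ^ 2 + 3 * N ^ 2))
          * volume B)) := by gcongr
    _ = 2 * (ENNReal.ofReal (C ^ 2) * (ENNReal.ofReal (194 * L ^ 2 * ρ ^ 2) * u.energy B))
        + 2 * (ENNReal.ofReal (C ^ 2 * h ^ 2 * (2 * L ^ 2 + 3 * N ^ 2))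
          * (‖c‖ₑ ^ 2 * volume B)) := by ring
    _ ≤ 2 * (ENNReal.ofReal (C ^ 2) * (ENNReal.ofReal (194 * L ^ 2 * ρ ^ 2) * u.energy B))
        + 2 * (ENNReal.ofReal (C ^ 2 * h ^ 2 * (2 * L ^ 2 + 3 * N ^ 2)) * u.energy B) := by
        gcongr
    _ = _ := by
      have h2 : (2 : ℝ≥0∞) = ENNReal.ofReal 2 := by simp
      rw [h2]
      simp only [← mul_assoc]
      rw [← ENNReal.ofReal_mul (by positivity), ← ENNReal.ofReal_mul (by positivity),
        ← ENNReal.ofReal_mul (by positivity), ← add_mul,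
        ← ENNReal.ofReal_add (by positivity) (by positivity)]
      congr 2
      rw [hρdef]
      ring

/-! ### From local to global estimates -/

/-- Integrals over all balls of a fixed radius average to a multiple of the integral. -/
lemma lintegral_setLIntegral_ball {F : E3 → ℝ≥0∞} (hF : Measurable F) (r : ℝ) :
    ∫⁻ x, ∫⁻ y in Metric.ball x r, F y = volume (Metric.ball (0 : E3) r) * ∫⁻ y, F y := by
  set s : Set (E3 × E3) := {p | dist p.2 p.1 < r}
  have hs : MeasurableSet s := (isOpen_lt (by fun_prop) continuous_const).measurableSet
  set K : E3 → E3 → ℝ≥0∞ := fun x y => s.indicator (fun p => F p.2) (x, y) with hK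
  have hKm : Measurable (Function.uncurry K) := (hF.comp measurable_snd).indicator hs
  calc ∫⁻ x, ∫⁻ y in Metric.ball x r, F y = ∫⁻ x, ∫⁻ y, K x y := by
        refine lintegral_congr fun x => ?_
        rw [← lintegral_indicator measurableSet_ball]
        rfl
    _ = ∫⁻ y, ∫⁻ x, K x y := lintegral_lintegral_swap hKm.aemeasurable
    _ = ∫⁻ y, volume (Metric.ball (0 : E3) r) * F y := by
        refine lintegral_congr fun y => ?_
        have e1 : (fun x => K x y) = (Metric.ball y r).indicator fun _ => F y := by
          funext x
          by_cases hx : x ∈ Metric.ball y r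
          · have : (x, y) ∈ s := by
              change dist y x < r
              rw [dist_comm]; exact hx
            rw [indicator_of_mem hx, hK]
            simp only [indicator_of_mem this]
          · have : (x, y) ∉ s := fun h => hx (by rw [Metric.mem_ball, dist_comm]; exact h)
            rw [indicator_of_notMem hx, hK]
            simp only [indicator_of_notMem this]
        rw [e1, lintegral_indicator measurableSet_ball, setLIntegral_const,
          Measure.addHaar_ball_center, mul_comm]
    _ = _ := lintegral_const_mul _ hF

/-- Estimates between concentric balls of fixed radii integrate to a global estimate. -/
lemma setLIntegral_le_of_ball_le {F G : E3 → ℝ≥0∞} (hF : Measurable F) (hG : Measurable G)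
    {A D : Set E3} (hA : MeasurableSet A) (hD : MeasurableSet D) {h R : ℝ} (hh : 0 < h)
    (hR : 0 < R) {k : ℝ≥0∞}
    (hAD : ∀ x y, y ∈ A → y ∈ Metric.ball x h → Metric.ball x (R * h) ⊆ D)
    (hle : ∀ x, Metric.ball x (R * h) ⊆ D →
      ∫⁻ y in Metric.ball x h, F y ≤ k * ∫⁻ y in Metric.ball x (R * h), G y) :
    ∫⁻ y in A, F y ≤ ENNReal.ofReal (R ^ 3) * k * ∫⁻ y in D, G y := by
  have v0 : volume (Metric.ball (0 : E3) h) ≠ 0 := (Metric.measure_ball_pos _ _ hh).ne'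
  have vt : volume (Metric.ball (0 : E3) h) ≠ ⊤ := measure_ball_lt_top.ne
  have hvol : volume (Metric.ball (0 : E3) (R * h))
      = ENNReal.ofReal (R ^ 3) * volume (Metric.ball (0 : E3) h) := by
    have h3 : Module.finrank ℝ E3 = 3 := by simp [E3]
    rw [Measure.addHaar_ball_mul_of_pos _ _ hR, h3]
  have hpt : ∀ x, ∫⁻ y in Metric.ball x h, A.indicator F y
      ≤ k * ∫⁻ y in Metric.ball x (R * h), D.indicator G y := by
    intro x
    by_cases hx : ∃ y ∈ A, y ∈ Metric.ball x h
    · obtain ⟨y, hyA, hyx⟩ := hx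
      have hsub := hAD x y hyA hyx
      calc _ ≤ ∫⁻ y in Metric.ball x h, F y := lintegral_mono fun y => indicator_le_self _ _ _
        _ ≤ _ := hle x hsub
        _ = _ := by
          congr 1
          exact setLIntegral_congr_fun measurableSet_ball fun y hy =>
            (indicator_of_mem (hsub hy) G).symm
    · push Not at hx
      have : ∫⁻ y in Metric.ball x h, A.indicator F y = ∫⁻ y in Metric.ball x h, 0 :=
        setLIntegral_congr_fun measurableSet_ball fun y hy =>
          indicator_of_notMem (fun hyA => hx y hyA hy) F
      rw [this, lintegral_zero]
      exact zero_le
  have hDG : Measurable (D.indicator G) := hG.indicator hD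
  have hDm : Measurable fun x => ∫⁻ y in Metric.ball x (R * h), D.indicator G y := by
    have hs : MeasurableSet {p : E3 × E3 | dist p.2 p.1 < R * h} :=
      (isOpen_lt (by fun_prop) continuous_const).measurableSet
    have := ((hDG.comp measurable_snd).indicator hs).lintegral_prod_right'
      (ν := (volume : Measure E3))
    convert this using 2 with x
    rw [← lintegral_indicator measurableSet_ball]
    rfl
  refine (ENNReal.mul_le_mul_iff_right v0 vt).1 ?_
  calc _ = ∫⁻ x, ∫⁻ y in Metric.ball x h, A.indicator F y := by
        rw [lintegral_setLIntegral_ball (hF.indicator hA), lintegral_indicator hA]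
    _ ≤ ∫⁻ x, k * ∫⁻ y in Metric.ball x (R * h), D.indicator G y := lintegral_mono hpt
    _ = k * (volume (Metric.ball (0 : E3) (R * h)) * ∫⁻ y in D, G y) := by
        rw [lintegral_const_mul _ hDm, lintegral_setLIntegral_ball hDG, lintegral_indicator hD]
    _ = _ := by rw [hvol]; ring

/-- Locality: the commutator vanishes where the multiplier is constant at the scale of the
projection. -/
lemma IsMultiplier.commutator_ae_eq_zero {m : E3 → ℂ} {M L : ℝ} (hm : IsMultiplier S m M L)
    (hΩ : IsOpen Ω) {V : Submodule ℂ (X S)} {P : X S →L[ℂ] V} (hP : ∀ v : V, P v = v)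
    {h r : ℝ} (hh : 0 < h)
    (hloc : ∀ x₀ ∈ Ω, ∀ u : X S,
      (∀ᵐ x ∂volume.restrict (Ω ∩ Metric.ball x₀ r), u.val x = 0) →
      ∀ᵐ x ∂volume.restrict (Ω ∩ Metric.ball x₀ h), (P u : X S).val x = 0)
    {U : Set E3} (hU : IsOpen U) (hUΩ : U ⊆ Ω) (hhr : h ≤ r)
    (hconst : ∀ x₀ ∈ U, ∃ c, ∀ x ∈ Metric.ball x₀ r, m x = c) {u : X S} (hu : u ∈ V) :
    ∀ᵐ x ∂volume.restrict U, (hm.mulOp u - P (hm.mulOp u)).val x = 0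
      ∧ (hm.mulOp u - P (hm.mulOp u)).nabla x = 0 := by
  set q : X S := hm.mulOp u - P (hm.mulOp u) with hq
  have hval : ∀ᵐ x ∂volume.restrict U, q.val x = 0 := by
    rw [ae_restrict_iff' hU.measurableSet, ae_iff]
    refine measure_null_of_locally_null _ fun x₀ hx₀ => ?_
    have hx₀U : x₀ ∈ U := by
      by_contra hcon; exact hx₀ fun hx => absurd hx hcon
    obtain ⟨c, hc⟩ := hconst x₀ hx₀U
    refine ⟨_, inter_mem self_mem_nhdsWithin
      (mem_nhdsWithin_of_mem_nhds (Metric.ball_mem_nhds x₀ hh)), ?_⟩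
    set v : X S := hm.mulOp u + (-c) • u with hv
    have hfix : ((P u : V) : X S) = u := congrArg _ (hP ⟨u, hu⟩)
    have hqv : q = v + (-1 : ℂ) • ((P v : V) : X S) := by
      simp only [hq, hv, map_add, map_smul, Submodule.coe_add, Submodule.coe_smul, hfix]
      module
    have hv0 : ∀ᵐ x ∂volume.restrict (Ω ∩ Metric.ball x₀ r), v.val x = 0 := by
      filter_upwards [X.ae_restrict_of_subset inter_subset_left (X.val_add (hm.mulOp u) ((-c) • u)),
        X.ae_restrict_of_subset inter_subset_left (hm.val_mulOp u),
        X.ae_restrict_of_subset inter_subset_left (X.val_smul (-c) u),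
        ae_restrict_mem (μ := volume) (hΩ.measurableSet.inter measurableSet_ball)]
        with x h1 h2 h3 hx
      rw [h1, h2, h3, hc x hx.2]
      ring
    have hPv := hloc x₀ (hUΩ hx₀U) v hv0
    have hq0 : ∀ᵐ x ∂volume.restrict (Ω ∩ Metric.ball x₀ h), q.val x = 0 := by
      rw [hqv]
      filter_upwards [X.ae_restrict_of_subset inter_subset_left
          (X.val_add v ((-1 : ℂ) • ((P v : V) : X S))),
        X.ae_restrict_of_subset inter_subset_left (X.val_smul (-1 : ℂ) ((P v : V) : X S)), hPv,
        ae_mono (Measure.restrict_mono (inter_subset_inter_right Ω (Metric.ball_subset_ball hhr))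
          le_rfl) hv0] with x h1 h2 h3 h4
      rw [h1, h2, h3, h4]
      ring
    rw [ae_restrict_iff' (hΩ.measurableSet.inter measurableSet_ball), ae_iff] at hq0
    refine measure_mono_null (fun x hx => ?_) hq0
    obtain ⟨hx1, hx2⟩ := hx
    have hx3 : ¬ (x ∈ U → q.val x = 0) := hx1
    push Not at hx3
    exact fun hx4 => hx3.2 (hx4 ⟨hUΩ hx3.1, hx2⟩)
  have hgrad := q.memX.weakGradient.ae_eq_zero hU hUΩ q.memX.memLp_grad hval
  exact hval.and hgrad

lemma X.enorm_sq_eq (u : X S) :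
    ‖u‖ₑ ^ 2 = ∫⁻ x in Ω, ENNReal.ofReal (RCLike.re (X.density u u x)) := by
  rw [← ofReal_sq_norm, X.norm_sq_eq]
  exact ofReal_integral_eq_lintegral_ofReal (X.integrable_density u u).re
    (ae_of_all _ fun x => X.re_density_self_nonneg u x)

/-- The norm of `X` is equivalent to the norm of `H¹` on sets where the weights are bounded:
upper bound, for functions that vanish outside of such a set. -/
lemma X.enorm_sq_le_energy {A : Set E3} (hA : MeasurableSet A) (hAΩ : A ⊆ Ω) {κ : ℝ}
    (hκ0 : 0 ≤ κ) (hκ : ∀ x ∈ A, S.w x ≤ κ ∧ ∀ g : C3, RCLike.re ⟪g, S.W x g⟫_ℂ ≤ κ * ‖g‖ ^ 2)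
    (u : X S) (hu : ∀ᵐ x ∂volume.restrict (Ω \ A), u.val x = 0 ∧ u.nabla x = 0) :
    ‖u‖ₑ ^ 2 ≤ ENNReal.ofReal κ * u.energy A := by
  rw [X.enorm_sq_eq, X.energy, ← lintegral_const_mul _ u.measurable_dens]
  have hz : ∫⁻ x in Ω \ A, ENNReal.ofReal (RCLike.re (X.density u u x)) = 0 := by
    rw [← lintegral_zero (μ := volume.restrict (Ω \ A))]
    refine lintegral_congr_ae (hu.mono fun x hx => ?_)
    simp only [X.re_density_self, hx.1, hx.2]
    simp
  rw [← lintegral_inter_add_sdiff _ Ω hA, hz, add_zero, inter_eq_self_of_subset_right hAΩ]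
  refine setLIntegral_mono' hA fun x hx => ?_
  rw [X.re_density_self, X.dens, ← ofReal_sq_norm, ← ofReal_sq_norm,
    ← ENNReal.ofReal_add (by positivity) (by positivity), ← ENNReal.ofReal_mul hκ0]
  refine ENNReal.ofReal_le_ofReal ?_
  have h1 := (hκ x hx).2 (u.nabla x)
  have h2 := mul_le_mul_of_nonneg_right (hκ x hx).1 (sq_nonneg ‖u.val x‖)
  linarith

/-- The norm of `X` controls the norm of `H¹` on sets where the weights are bounded below. -/
lemma X.energy_le_enorm_sq {D : Set E3} (hD : MeasurableSet D) (hDΩ : D ⊆ Ω) {κ : ℝ} (hκ1 : 1 ≤ κ)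
    (hκ : ∀ x ∈ D, ∀ g : C3, ‖g‖ ^ 2 ≤ κ * RCLike.re ⟪g, S.W x g⟫_ℂ) (u : X S) :
    u.energy D ≤ ENNReal.ofReal κ * ‖u‖ₑ ^ 2 := by
  rw [X.enorm_sq_eq, ← lintegral_const_mul' _ _ ENNReal.ofReal_ne_top]
  refine le_trans ?_ (lintegral_mono_set hDΩ)
  refine setLIntegral_mono_ae' hD (ae_of_all _ fun x hx => ?_)
  rw [X.re_density_self, X.dens, ← ofReal_sq_norm, ← ofReal_sq_norm,
    ← ENNReal.ofReal_add (by positivity) (by positivity), ← ENNReal.ofReal_mul (by linarith)]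
  refine ENNReal.ofReal_le_ofReal ?_
  have h1 := hκ x hx (u.nabla x)
  have h2 : 1 ≤ κ * S.w x := one_le_mul_of_one_le_of_one_le hκ1 (one_le_w S x)
  have h3 := mul_le_mul_of_nonneg_right h2 (sq_nonneg ‖u.val x‖)
  linarith

/-! ### The global commutator estimate -/

/-- Operators on finite dimensional spaces are Fredholm with index zero. -/
lemma isFredholmIndexZero_of_finiteDimensional {V : Type*} [NormedAddCommGroup V]
    [NormedSpace ℂ V] [FiniteDimensional ℂ V] (T : V →L[ℂ] V) : IsFredholmIndexZero T := by
  constructor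
  · -- modulo operators of finite rank, all operators vanish
    exact ContinuousLinearMap.IsFredholm.of_isQuasiInverse (v := 0)
      ⟨LinearMap.FiniteRangeSetoid.equiv_iff_hasFiniteRange.2 .of_finite_dom,
        LinearMap.FiniteRangeSetoid.equiv_iff_hasFiniteRange.2 .of_finite_dom⟩
  · have h1 := LinearMap.finrank_range_add_finrank_ker (T : V →ₗ[ℂ] V)
    have h2 := Submodule.finrank_quotient_add_finrank (LinearMap.range (T : V →ₗ[ℂ] V))
    change Module.finrank ℂ (LinearMap.ker (T : V →ₗ[ℂ] V))
      = Module.finrank ℂ (V ⧸ LinearMap.range (T : V →ₗ[ℂ] V))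
    omega

/-- The commutator of a radial multiplier, constant near the start of the scaling and far away,
with local projections is of the order of the width `h n`, in the discrete operator norm. -/
lemma IsMultiplier.eventually_commutator_le (hΩ : IsOpen Ω) {m : E3 → ℂ} {M L N : ℝ}
    (hm : IsMultiplier S m M L)
    (hN : ∀ x i, ‖grad (fun y => grad m y i) x‖ ≤ N) {a b : ℝ} {c l : ℂ} (ha : S.r₁ < a)
    (h1 : ∀ x, ‖x‖ ≤ a → m x = c) (h2 : ∀ x, b ≤ ‖x‖ → m x = l)
    {Xh : ℕ → Submodule ℂ (X S)} {h : ℕ → ℝ} {P : ∀ n, X S →L[ℂ] Xh n}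
    (hP : IsLocalProjection Xh h P) (hconst : HasLocalConstants Xh) :
    ∃ K : ℝ, ∀ᶠ n in atTop, ∀ u ∈ Xh n,
      ‖hm.mulOp u - P n (hm.mulOp u)‖ₑ ≤ ENNReal.ofReal (K * h n) * ‖u‖ₑ := by
  obtain ⟨C, R, -, hR, hloc, happ⟩ := hP.acts_locally
  have hR0 : 0 < R := by linarith
  -- The commutator is supported in `A`, and the local estimates are used inside `D`; the margin `s`
  -- leaves room for balls of radius `R h`, and keeps `D` away from the sphere of radius `r₁`, where
  -- the weights may be discontinuous.
  set s := min ((a - S.r₁) / 4) 1 with hs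
  have hs0 : 0 < s := lt_min (by linarith) one_pos
  have hs1 : s ≤ 1 := min_le_right _ _
  have hs2 : s ≤ (a - S.r₁) / 4 := min_le_left _ _
  set A := annulus (a - s) (b + s) with hA
  set D := annulus (a - 3 * s) (b + 3 * s) with hD
  have hDr : S.r₁ < a - 3 * s := by linarith
  have hDΩ : D ⊆ Ω := S.annulus_subset hDr
  have hAD : A ⊆ D := fun x hx => ⟨by linarith [hx.1], by linarith [hx.2]⟩
  have hAm : MeasurableSet A := (isClosed_annulus _ _).measurableSet
  have hDm : MeasurableSet D := (isClosed_annulus _ _).measurableSet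
  have hDc : IsCompact D := isCompact_annulus _ _
  obtain ⟨κ, hκ1, hκ⟩ := S.exists_weight_bound hDr (b + 3 * s)
  have hκ0 : 0 ≤ κ := by linarith
  obtain ⟨n₁, hn₁⟩ := happ D hDΩ hDc
  obtain ⟨n₂, hn₂⟩ := hconst D hDΩ hDc
  set k := C ^ 2 * (388 * L ^ 2 * R ^ 2 + 4 * L ^ 2 + 6 * N ^ 2) with hk
  have hk0 : 0 ≤ k := by positivity
  have hsmall : ∀ᶠ n in atTop, R * h n < s := by
    have := hP.h_lim.const_mul R
    rw [mul_zero] at this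
    exact this.eventually (gt_mem_nhds hs0)
  refine ⟨√(κ * (R ^ 3 * k * κ)), ?_⟩
  filter_upwards [hsmall, eventually_gt_atTop n₁, eventually_gt_atTop n₂] with n hns hn1 hn2 u hu
  have hh : 0 < h n := hP.h_pos n
  have hhR : h n ≤ R * h n := le_mul_of_one_le_left hh.le hR.le
  set q : X S := hm.mulOp u - P n (hm.mulOp u) with hq
  obtain ⟨χ, -, hχ⟩ := hn₂ n hn2
  have hzero : ∀ᵐ x ∂volume.restrict (Ω \ A), q.val x = 0 ∧ q.nabla x = 0 := by
    have hU : IsOpen (Ω \ A) := hΩ.sdiff (isClosed_annulus _ _)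
    refine hm.commutator_ae_eq_zero hΩ (hP.proj n) hh (hloc n) hU sdiff_subset hhR ?_ hu
    intro x₀ hx₀
    have hx' : ‖x₀‖ < a - s ∨ b + s < ‖x₀‖ := by
      by_contra hcon; push Not at hcon; exact hx₀.2 hcon
    have hd : ∀ x ∈ Metric.ball x₀ (R * h n), |‖x‖ - ‖x₀‖| < s := fun x hx =>
      (abs_norm_sub_norm_le x x₀).trans_lt
        ((by rw [← dist_eq_norm]; exact Metric.mem_ball.1 hx : ‖x - x₀‖ < R * h n).trans hns)
    rcases hx' with h' | h'
    · exact ⟨c, fun x hx => h1 x (by have := (abs_lt.1 (hd x hx)).2; linarith)⟩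
    · exact ⟨l, fun x hx => h2 x (by have := (abs_lt.1 (hd x hx)).1; linarith)⟩
  have hball : ∀ x y, y ∈ A → y ∈ Metric.ball x (h n) → Metric.ball x (R * h n) ⊆ D := by
    intro x y hy hyx z hz
    have d1 : |‖y‖ - ‖x‖| < s := (abs_norm_sub_norm_le y x).trans_lt
      (((by rw [← dist_eq_norm]; exact Metric.mem_ball.1 hyx : ‖y - x‖ < h n).trans_le
        hhR).trans hns)
    have d2 : |‖z‖ - ‖x‖| < s := (abs_norm_sub_norm_le z x).trans_lt
      ((by rw [← dist_eq_norm]; exact Metric.mem_ball.1 hz : ‖z - x‖ < R * h n).trans hns)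
    rw [abs_lt] at d1 d2
    exact ⟨by linarith [hy.1], by linarith [hy.2]⟩
  have henergy : q.energy A ≤ ENNReal.ofReal (R ^ 3) * ENNReal.ofReal (k * h n ^ 2)
      * u.energy D := by
    refine setLIntegral_le_of_ball_le q.measurable_dens u.measurable_dens hAm hDm hh hR0 hball ?_
    intro x₀ hx₀
    refine hm.energy_commutator_le hN (hP.proj n) hh hR (hns.le.trans hs1) (hx₀.trans hDΩ)
      (X.ae_restrict_of_subset (Ω := D) hx₀ hχ) (hn₁ n hn1 x₀ hx₀) hu
  have hup := X.enorm_sq_le_energy hAm (hAD.trans hDΩ) hκ0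
    (fun x hx => ⟨(hκ x (hAD hx)).1, fun g => ((hκ x (hAD hx)).2 g).1⟩) q hzero
  have hlow := X.energy_le_enorm_sq hDm hDΩ hκ1 (fun x hx g => ((hκ x hx).2 g).2) u
  refine (ENNReal.pow_le_pow_left_iff two_ne_zero).1 ?_
  calc ‖q‖ₑ ^ 2 ≤ ENNReal.ofReal κ * (ENNReal.ofReal (R ^ 3) * ENNReal.ofReal (k * h n ^ 2)
        * (ENNReal.ofReal κ * ‖u‖ₑ ^ 2)) := by
        refine hup.trans ?_
        gcongr
        exact henergy.trans (by gcongr)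
    _ = (ENNReal.ofReal (√(κ * (R ^ 3 * k * κ)) * h n) * ‖u‖ₑ) ^ 2 := by
        rw [mul_pow, ← ENNReal.ofReal_pow (by positivity), mul_pow,
          Real.sq_sqrt (by positivity)]
        simp only [← mul_assoc]
        rw [← ENNReal.ofReal_mul hκ0, ← ENNReal.ofReal_mul (by positivity),
          ← ENNReal.ofReal_mul (by positivity)]
        congr 2
        ring

end PML

theorem theorem5p4
    (Ω : Set PML.E3) (hΩ : PML.IsLipschitzDomain Ω)
    (hΩ_compact : IsCompact Ωᶜ) (hΩ_nonempty : Ωᶜ.Nonempty)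
    (S : PML.Profile Ω) (hS : S.IsAsymptotic)
    (Xh : ℕ → Submodule ℂ (PML.X S)) [∀ n, FiniteDimensional ℂ (Xh n)]
    (hXh : ∀ u : PML.X S, Tendsto (fun n => (Xh n).starProjection u) atTop (𝓝 u))
    (h : ℕ → ℝ) (P : ∀ n, PML.X S →L[ℂ] Xh n) (hP : PML.IsLocalProjection Xh h P)
    (hconst : PML.HasLocalConstants Xh)
    (ε₀ : ℂ → ℝ) (hε₀ : ∀ ω, ω ≠ 0 → 0 < ε₀ ω)
    (ηε : ℂ → ℝ → ℂ)
    (hηε : ∀ ω, ω ≠ 0 → PML.IsSmoothing S.r₁ (ε₀ ω) (S.symbol ω) (ηε ω)) :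
    ∀ ω : ℂ, ω ≠ 0 → ∃ T : PML.X S →L[ℂ] PML.X S, PML.IsRadialMul (ηε ω) T ∧
      (∀ n, PML.IsFredholmIndexZero (PML.galerkin (P n) T)) ∧
      Tendsto (fun n => PML.discreteNorm
          (T ∘L (Xh n).subtypeL - (Xh n).subtypeL ∘L PML.galerkin (P n) T))
        atTop (𝓝 0) := by
  intro ω hω
  have hη := hηε ω hω
  obtain ⟨a, ha, hleft⟩ := hη.left
  obtain ⟨b, l, -, -, hright⟩ := hη.right
  have hc : ∀ r, 0 ≤ r → r ≤ a → ηε ω r = S.symbol ω S.r₁ := by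
    intro r hr hra
    rcases le_total r S.r₁ with h' | h'
    · rw [hη.inside r hr h', hleft _ le_rfl ha.le]
    · exact hleft r h' hra
  have hm := PML.contDiff_comp_norm S.r₁_pos ha hη.smooth hc
  have h1 : ∀ x : PML.E3, ‖x‖ ≤ a → ηε ω ‖x‖ = S.symbol ω S.r₁ :=
    fun x hx => hc _ (norm_nonneg x) hx
  have h2 : ∀ x : PML.E3, b ≤ ‖x‖ → ηε ω ‖x‖ = l := fun x hx => hright _ hx
  obtain ⟨M, L, N, hmul, hN⟩ := PML.exists_isMultiplier S hm ha h1 h2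
  refine ⟨hmul.mulOp, fun u => hmul.val_mulOp u,
    fun n => PML.isFredholmIndexZero_of_finiteDimensional _, ?_⟩
  obtain ⟨K, hK⟩ := hmul.eventually_commutator_le hΩ.isOpen hN ha h1 h2 hP hconst
  have hlim : Tendsto (fun n => ENNReal.ofReal (K * h n)) atTop (𝓝 0) := by
    have := ENNReal.tendsto_ofReal (hP.h_lim.const_mul K)
    simpa using this
  refine tendsto_of_tendsto_of_tendsto_of_le_of_le' tendsto_const_nhds hlim
    (Eventually.of_forall fun n => zero_le) ?_
  filter_upwards [hK] with n hn
  refine iSup₂_le fun v _ => ENNReal.div_le_of_le_mul ?_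
  exact hn v v.2
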